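/- Let $R$ be a complete valuation ring which is not a field: an integral domain with field of fractions $K$ such that for every $x\in K^\times$ one has $x\in R$ or $x^{-1}\in R$, such that the totally ordered abelian group $K^\times/R^\times$ is isomorphic to an ordered subgroup of $\mathbb{R}$, and such that $R$ is complete for the norm $|\cdot|$ induced by the valuation $K^\times\to K^\times/R^\times\subseteq\mathbb{R}$. Let $F$ be the residue field of $R$, and suppose that $K$ is algebraically closed. For $S=R$ or $S=K$, with the norm $|\cdot|$, let $\mathbb{A}^1_S$ be the set of all non-zero multiplicative seminorms on the polynomial ring $S[t]$ whose restrictions to $S$ are contractive (that is, bounded above by $|\cdot|$), equipped with the topology of pointwise convergence on $S[t]$. Then the following hold. (a) $\mathbb{A}^1_R$ is path connected. (b) $\mathbb{A}^1_R$ is locally path connected, i.e. every point has a neighborhood basis consisting of path connected open sets. (c) $\mathbb{A}^1_R$ is first countable if and only if $F$ is countable and $\mathbb{A}^1_K$ is first countable. -/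

import Mathlib

open Polynomial
open scoped NNReal

/-- The one-dimensional affine analytic space over a commutative ring `S` whose norm is the
absolute value `v`: the nonzero multiplicative seminorms on `S[t]` that are contractive on `S`.
A `MulRingSeminorm` sends `1` to `1`, which for a multiplicative seminorm means that it is
nonzero. -/
def AffineAnalyticLine {S : Type*} [CommRing S] (v : AbsoluteValue S ℝ) : Type _ :=
  {μ : MulRingSeminorm S[X] // ∀ a : S, μ (C a) ≤ v a}

namespace AffineAnalyticLine

/-- The topology of pointwise convergence on `S[t]`. -/
noncomputable instance instTopologicalSpace {S : Type*} [CommRing S] (v : AbsoluteValue S ℝ) :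
    TopologicalSpace (AffineAnalyticLine v) :=
  TopologicalSpace.induced (fun μ (p : S[X]) => μ.1 p) inferInstance

end AffineAnalyticLine

section

variable (R : Type*) [CommRing R] [IsDomain R] [ValuationRing R]
  (K : Type*) [Field K] [Algebra R K] [IsFractionRing R K]

/-- The absolute value on the field of fractions `K` of a valuation ring `R` that is induced by
the canonical valuation `K → K / Rˣ` and an embedding `ρ` of the ordered group `Kˣ / Rˣ` (with a
zero adjoined; written multiplicatively, so that `R` is the set of elements of value at most `1`)
into the positive real numbers. -/
noncomputable def ValuationRing.inducedAbs (ρ : ValuationRing.ValueGroup R K →*₀ ℝ≥0)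
    (hρ : StrictMono ρ) : AbsoluteValue K ℝ where
  toFun x := (ρ (ValuationRing.valuation R K x) : ℝ)
  map_mul' x y := by simp
  nonneg' x := NNReal.coe_nonneg _
  eq_zero' x := by simp
  add_le' x y := by
    have h : ρ (ValuationRing.valuation R K (x + y)) ≤
        max (ρ (ValuationRing.valuation R K x)) (ρ (ValuationRing.valuation R K y)) := by
      rw [← hρ.monotone.map_max]
      exact hρ.monotone ((ValuationRing.valuation R K).map_add x y)
    exact_mod_cast h.trans (max_le_add_of_nonneg zero_le zero_le)

/-- The restriction to `R` of the induced absolute value. -/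
noncomputable def ValuationRing.inducedAbsOnRing (ρ : ValuationRing.ValueGroup R K →*₀ ℝ≥0)
    (hρ : StrictMono ρ) : AbsoluteValue R ℝ :=
  (ValuationRing.inducedAbs R K ρ hρ).comp (f := algebraMap R K) (IsFractionRing.injective R K)

end

/-!
Write `w` for the valuation of `K` and fix `ϖ` in `R` with `0 < w ϖ < 1`. A contractive seminorm
is at most `1` on the integers, hence nonarchimedean, so points of the affine line are valuations
on `R[X]` with values in `ℝ≥0`. Since `K` is algebraically closed, every polynomial over `R` is a
product of linear polynomials `a X + b` over `R` (`exists_eq_linear_mul`; a root `α` outside `R`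
contributes the factor `1 - α⁻¹ X`). Points and their topology are therefore determined by the
values at linear polynomials. The base valuation `N = μ|_R` of a point is either a power `w ^ s`
with `1 ≤ s`, if `μ ϖ ≠ 0` (`contractive_eq_rpow`), or the trivial valuation of the residue field
(`contractive_eq_resVal`).

All paths are built from the disc seminorms `disc N r c`, Gauss norms of radius `r` in powers of
`X - c`, which depend continuously on `N` and `r`. With the tautological centre `X` over `(R[X],
μ)` they give the flow `raise μ r`, with value `max (μ a * r) (μ (a X + b))` at `a X + b`. Once
`r` is at least the value of `μ` at `X - c`, raising `μ` gives the disc of centre `c` over the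
base valuation of `μ` (`raise_eq_disc`). A base valuation `N` degenerates along `N ^ (1 / u)`, `u
→ 0`, to the trivial valuation of the residue field.

Every point is raised to a disc of centre `0`, degenerated, and moved to the Gauss point, so the
space is path connected. For local path connectedness it is enough to join all points `ν` near `μ`
to `μ` within a given neighbourhood, which may be taken convex for the values at linear
polynomials; monotone paths stay inside it as soon as their end points do. The infimum of the
values of `μ` at polynomials `X - c` is a radius at which raising does not change `μ`, so there is
a centre `c` for which raising `μ` and all nearby `ν` to discs of centre `c` stays in the
neighbourhood (`exists_raise_mem`). These discs are then joined by varying base valuation and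
radius.

The affine line over `K` is a subspace of that over `R`. At the Gauss point over the trivial
valuation of the residue field there is one branch for each residue class, and a neighbourhood
contains all but finitely many branches, so first countability forces the residue field to be
countable. Conversely, the points with `μ ϖ ≠ 0` form an open set that embeds into the product of
`ℝ` and the affine line over `K`, by the exponent `s` and the point whose power `s` is `μ`; and
near a point with `μ ϖ = 0` the topology is generated by the values at `ϖ` and at `X + a`, for `a`
in a set of representatives of the residue field.
-/

open Filter Topology unitInterval

/-! ### Gauss valuations -/

section Gauss

variable {S : Type*} [CommRing S]

lemma gaussSup_coeff_le (N : Valuation S ℝ≥0) (r : ℝ≥0) (p : S[X]) (i : ℕ) :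
    N (p.coeff i) * r ^ i ≤ p.support.sup fun i => N (p.coeff i) * r ^ i := by
  by_cases h : i ∈ p.support
  · exact Finset.le_sup (f := fun i => N (p.coeff i) * r ^ i) h
  · simp [notMem_support_iff.1 h]

lemma gaussSup_eq_coeff (N : Valuation S ℝ≥0) (r : ℝ≥0) (p : S[X]) :
    ∃ i, N (p.coeff i) * r ^ i = p.support.sup fun i => N (p.coeff i) * r ^ i := by
  rcases p.support.eq_empty_or_nonempty with h | h
  · exact ⟨0, by simp [support_eq_empty.1 h]⟩
  · obtain ⟨i, -, hi⟩ := Finset.exists_mem_eq_sup _ h fun i => N (p.coeff i) * r ^ i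
    exact ⟨i, hi.symm⟩

/-- The Gauss norm is multiplicative: if `i` and `j` are the least indices at which the norms of `p`
and `q` are attained, the coefficient of `p * q` of index `i + j` has a single dominant term. -/
lemma gaussSup_mul (N : Valuation S ℝ≥0) (r : ℝ≥0) (p q : S[X]) :
    ((p * q).support.sup fun i => N ((p * q).coeff i) * r ^ i) =
      (p.support.sup fun i => N (p.coeff i) * r ^ i) *
        (q.support.sup fun i => N (q.coeff i) * r ^ i) := by
  classical
  set A := p.support.sup fun i => N (p.coeff i) * r ^ i with hA
  set B := q.support.sup fun i => N (q.coeff i) * r ^ i with hB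
  have hpA : ∀ i, N (p.coeff i) * r ^ i ≤ A := gaussSup_coeff_le N r p
  have hqB : ∀ i, N (q.coeff i) * r ^ i ≤ B := gaussSup_coeff_le N r q
  have hterm : ∀ (n : ℕ) (x : ℕ × ℕ), x ∈ Finset.HasAntidiagonal.antidiagonal n →
      N (p.coeff x.1 * q.coeff x.2) * r ^ n =
        (N (p.coeff x.1) * r ^ x.1) * (N (q.coeff x.2) * r ^ x.2) := by
    intro n x hx
    rw [← Finset.HasAntidiagonal.mem_antidiagonal.1 hx, pow_add, map_mul]
    ring
  apply le_antisymm
  · refine Finset.sup_le fun n _ => ?_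
    rcases eq_or_ne (r ^ n) 0 with hr | hr
    · simp [hr]
    rw [← le_div_iff₀ (pos_iff_ne_zero.2 hr), coeff_mul]
    refine N.map_sum_le fun x hx => ?_
    rw [le_div_iff₀ (pos_iff_ne_zero.2 hr), hterm n x hx]
    exact mul_le_mul' (hpA _) (hqB _)
  · rcases eq_or_ne A 0 with hA0 | hA0
    · simp [hA0]
    rcases eq_or_ne B 0 with hB0 | hB0
    · simp [hB0]
    have hi := gaussSup_eq_coeff N r p
    have hj := gaussSup_eq_coeff N r q
    set i := Nat.find hi with hidef
    set j := Nat.find hj with hjdef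
    have hiA : N (p.coeff i) * r ^ i = A := Nat.find_spec hi
    have hjB : N (q.coeff j) * r ^ j = B := Nat.find_spec hj
    have hlt_i : ∀ k < i, N (p.coeff k) * r ^ k < A :=
      fun k hk => lt_of_le_of_ne (hpA k) (Nat.find_min hi hk)
    have hlt_j : ∀ k < j, N (q.coeff k) * r ^ k < B :=
      fun k hk => lt_of_le_of_ne (hqB k) (Nat.find_min hj hk)
    have hri : r ^ i ≠ 0 := fun h => hA0 (by rw [← hiA, h, mul_zero])
    have hrj : r ^ j ≠ 0 := fun h => hB0 (by rw [← hjB, h, mul_zero])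
    have hr : 0 < r ^ (i + j) := by
      rw [pow_add]; exact mul_pos (pos_iff_ne_zero.2 hri) (pos_iff_ne_zero.2 hrj)
    have hmem : (i, j) ∈ Finset.HasAntidiagonal.antidiagonal (i + j) := by simp
    have hsum : N ((p * q).coeff (i + j)) = N (p.coeff i * q.coeff j) := by
      rw [coeff_mul]
      refine N.map_sum_eq_of_lt (f := fun x : ℕ × ℕ => p.coeff x.1 * q.coeff x.2) hmem ?_
      intro x hx
      have hx1 := (Finset.mem_sdiff.1 hx).1
      have hne : x ≠ (i, j) := by simpa using (Finset.mem_sdiff.1 hx).2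
      refine lt_of_mul_lt_mul_right (a := r ^ (i + j)) ?_ zero_le
      rw [hterm _ x hx1, hterm _ _ hmem, hiA, hjB]
      have hx2 := Finset.HasAntidiagonal.mem_antidiagonal.1 hx1
      rcases lt_trichotomy x.1 i with h | h | h
      · exact (mul_le_mul_right (hqB _) _).trans_lt
          (mul_lt_mul_of_pos_right (hlt_i _ h) (pos_iff_ne_zero.2 hB0))
      · exact absurd (Prod.ext h (by simp only; omega)) hne
      · have h' : x.2 < j := by omega
        exact (mul_le_mul_left (hpA _) _).trans_lt
          (mul_lt_mul_of_pos_left (hlt_j _ h') (pos_iff_ne_zero.2 hA0))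
    calc A * B = N ((p * q).coeff (i + j)) * r ^ (i + j) := by
          rw [hsum, hterm _ _ hmem, hiA, hjB]
      _ ≤ _ := gaussSup_coeff_le N r (p * q) (i + j)

/-- The Gauss valuation of radius `r` on `S[X]` over a valuation `N` on `S`. Neither `N` is required
to have trivial support nor `r` to be positive. -/
noncomputable def gaussVal (N : Valuation S ℝ≥0) (r : ℝ≥0) : Valuation S[X] ℝ≥0 where
  toFun p := p.support.sup fun i => N (p.coeff i) * r ^ i
  map_zero' := by simp
  map_one' := by
    apply le_antisymm
    · refine Finset.sup_le fun i _ => ?_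
      rcases eq_or_ne i 0 with rfl | hi
      · simp
      · simp [coeff_one, hi]
    · simpa using gaussSup_coeff_le N r 1 0
  map_mul' := gaussSup_mul N r
  map_add_le_max' p q := by
    refine Finset.sup_le fun i _ => ?_
    calc N ((p + q).coeff i) * r ^ i
        ≤ max (N (p.coeff i)) (N (q.coeff i)) * r ^ i := by
          rw [coeff_add]; gcongr; exact N.map_add _ _
      _ = max (N (p.coeff i) * r ^ i) (N (q.coeff i) * r ^ i) :=
          max_mul_of_nonneg _ _ zero_le
      _ ≤ _ := max_le_max (gaussSup_coeff_le N r p i) (gaussSup_coeff_le N r q i)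

lemma gaussVal_apply (N : Valuation S ℝ≥0) (r : ℝ≥0) (p : S[X]) :
    gaussVal N r p = p.support.sup fun i => N (p.coeff i) * r ^ i := rfl

lemma gaussVal_linear (N : Valuation S ℝ≥0) (r : ℝ≥0) (a b : S) :
    gaussVal N r (C a * X + C b) = max (N a * r) (N b) := by
  apply le_antisymm
  · refine Finset.sup_le fun i _ => ?_
    rcases i with _ | _ | i
    · simp
    · simp
    · simp
  · refine max_le ?_ ?_
    · refine le_trans (le_of_eq ?_) (gaussSup_coeff_le N r (C a * X + C b) 1)
      simp
    · refine le_trans (le_of_eq ?_) (gaussSup_coeff_le N r (C a * X + C b) 0)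
      simp

variable {A : Type*} [CommRing A] [Algebra A S]

/-- The seminorm of the closed disc of centre `c` and radius `r` over the valuation `N`: the
supremum norm of the coefficients of the expansion in powers of `X - c`, with weight `r ^ i` in
degree `i`. The centre may lie in an `A`-algebra `S`. -/
noncomputable def discVal (A : Type*) [CommRing A] [Algebra A S] (N : Valuation S ℝ≥0) (r : ℝ≥0)
    (c : S) : Valuation A[X] ℝ≥0 :=
  (gaussVal N r).comap (aeval (R := A) (X + C c)).toRingHom

lemma discVal_apply (N : Valuation S ℝ≥0) (r : ℝ≥0) (c : S) (p : A[X]) :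
    discVal A N r c p = gaussVal N r (aeval (X + C c) p) := rfl

@[simp]
lemma discVal_linear (N : Valuation S ℝ≥0) (r : ℝ≥0) (c : S) (a b : A) :
    discVal A N r c (C a * X + C b) =
      max (N (algebraMap A S a) * r) (N (algebraMap A S a * c + algebraMap A S b)) := by
  rw [discVal_apply, ← gaussVal_linear]
  congr 1
  simp [Polynomial.algebraMap_apply, mul_add, add_assoc]

@[simp]
lemma discVal_C (N : Valuation S ℝ≥0) (r : ℝ≥0) (c : S) (b : A) :
    discVal A N r c (C b) = N (algebraMap A S b) := by
  simpa using discVal_linear N r c 0 b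

lemma tendsto_discVal {ι : Type*} {l : Filter ι} {N : ι → Valuation S ℝ≥0} {N₀ : Valuation S ℝ≥0}
    {r : ι → ℝ≥0} {r₀ : ℝ≥0} (hN : ∀ x, Tendsto (fun i => N i x) l (𝓝 (N₀ x)))
    (hr : Tendsto r l (𝓝 r₀)) (c : S) (p : A[X]) :
    Tendsto (fun i => discVal A (N i) (r i) c p) l (𝓝 (discVal A N₀ r₀ c p)) := by
  simp only [discVal_apply, gaussVal_apply]
  exact Filter.Tendsto.finset_sup_nhds_apply fun i _ => (hN _).mul (hr.pow i)

end Gauss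

/-! ### Points of the affine line as valuations -/

/-- A multiplicative seminorm that is bounded by `1` on the natural numbers is nonarchimedean. -/
lemma MulRingSeminorm.isNonarchimedean_of_natCast_le_one {B : Type*} [CommRing B]
    (μ : MulRingSeminorm B) (h : ∀ n : ℕ, μ n ≤ 1) : IsNonarchimedean μ := by
  intro x y
  have h0 : ∀ z, 0 ≤ μ z := fun z => apply_nonneg μ z
  set M := max (μ x) (μ y) with hM
  have hM0 : 0 ≤ M := (h0 x).trans (le_max_left _ _)
  have key : ∀ m : ℕ, μ (x + y) ^ m ≤ (m + 1) * M ^ m := by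
    intro m
    have hs : ∀ (s : Finset ℕ) (f : ℕ → B), μ (∑ i ∈ s, f i) ≤ ∑ i ∈ s, μ (f i) := by
      intro s f
      classical
      induction s using Finset.induction_on with
      | empty => simp
      | insert a s ha ih =>
        rw [Finset.sum_insert ha, Finset.sum_insert ha]
        exact (map_add_le_add μ _ _).trans (by gcongr)
    calc μ (x + y) ^ m = μ ((x + y) ^ m) := (map_pow μ _ _).symm
      _ ≤ ∑ k ∈ Finset.range (m + 1), μ (x ^ k * y ^ (m - k) * (m.choose k : ℕ)) := by
          rw [add_pow]; exact hs _ _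
      _ ≤ ∑ k ∈ Finset.range (m + 1), M ^ m := by
          refine Finset.sum_le_sum fun k hk => ?_
          have hk' : k + (m - k) = m := by
            have := Finset.mem_range.1 hk; omega
          calc μ (x ^ k * y ^ (m - k) * (m.choose k : ℕ))
              = μ x ^ k * μ y ^ (m - k) * μ (m.choose k : ℕ) := by
                simp only [map_mul, map_pow]
            _ ≤ M ^ k * M ^ (m - k) * 1 := by
                have := h0 x
                have := h0 y
                have := h0 (m.choose k : ℕ)
                gcongr
                · exact le_max_left _ _
                · exact le_max_right _ _
                · exact h _
            _ = M ^ m := by rw [mul_one, ← pow_add, hk']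
      _ = (m + 1) * M ^ m := by simp
  rcases hM0.eq_or_lt with h00 | hpos
  · have := key 1
    rw [← h00] at this
    simpa [← h00] using this
  · by_contra! hlt
    obtain ⟨m, hm⟩ := Real.exists_natCast_add_one_lt_pow_of_one_lt ((one_lt_div hpos).2 hlt)
    rw [div_pow, lt_div_iff₀ (by positivity)] at hm
    exact absurd (key m) (by linarith)

namespace AffineAnalyticLine

section

variable {S : Type*} [CommRing S] {v : AbsoluteValue S ℝ}

lemma isNonarchimedean (hv : ∀ n : ℕ, v n ≤ 1) (μ : AffineAnalyticLine v) :
    IsNonarchimedean μ.1 := by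
  refine μ.1.isNonarchimedean_of_natCast_le_one fun n => ?_
  have := μ.2 n
  rw [map_natCast] at this
  exact this.trans (hv n)

/-- A point of the affine line over a nonarchimedean ring, seen as a valuation. -/
noncomputable def val (hv : ∀ n : ℕ, v n ≤ 1) (μ : AffineAnalyticLine v) :
    Valuation S[X] ℝ≥0 where
  toFun p := ⟨μ.1 p, apply_nonneg μ.1 p⟩
  map_zero' := Subtype.ext (map_zero μ.1)
  map_one' := Subtype.ext (map_one μ.1)
  map_mul' p q := Subtype.ext (map_mul μ.1 p q)
  map_add_le_max' p q := by
    exact (le_max_iff.1 (isNonarchimedean hv μ p q)).elim (fun h => le_max_of_le_left h)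
      fun h => le_max_of_le_right h

@[simp]
lemma coe_val (hv : ∀ n : ℕ, v n ≤ 1) (μ : AffineAnalyticLine v) (p : S[X]) :
    (val hv μ p : ℝ) = μ.1 p := rfl

/-- The point of the affine line given by a valuation on `S[X]` that is contractive on `S`. -/
noncomputable def ofVal (N : Valuation S[X] ℝ≥0) (h : ∀ a : S, (N (C a) : ℝ) ≤ v a) :
    AffineAnalyticLine v :=
  ⟨{ toFun := fun p => N p
     map_zero' := by simp
     map_one' := by simp
     map_mul' := fun p q => by simp
     neg' := fun p => by simp
     add_le' := fun p q => by
      exact_mod_cast (N.map_add p q).trans (max_le_add_of_nonneg zero_le zero_le) }, h⟩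

@[simp]
lemma val_ofVal (hv : ∀ n : ℕ, v n ≤ 1) (N : Valuation S[X] ℝ≥0)
    (h : ∀ a : S, (N (C a) : ℝ) ≤ v a) : val hv (ofVal N h) = N :=
  Valuation.ext fun _ => Subtype.ext rfl

lemma val_injective (hv : ∀ n : ℕ, v n ≤ 1) :
    Function.Injective (val hv : AffineAnalyticLine v → _) := by
  intro μ ν h
  refine Subtype.ext (DFunLike.ext _ _ fun p => ?_)
  rw [← coe_val hv, ← coe_val hv, h]

lemma val_C_le (hv : ∀ n : ℕ, v n ≤ 1) (μ : AffineAnalyticLine v) (a : S) :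
    (val hv μ (C a) : ℝ) ≤ v a := μ.2 a

lemma nhds_eq (hv : ∀ n : ℕ, v n ≤ 1) (μ : AffineAnalyticLine v) :
    𝓝 μ = ⨅ p, comap (fun ν => val hv ν p) (𝓝 (val hv μ p)) := by
  rw [nhds_induced, nhds_pi, Filter.pi, comap_iInf]
  refine iInf_congr fun p => ?_
  rw [comap_comap, NNReal.isEmbedding_coe.isInducing.nhds_eq_comap, comap_comap]
  rfl

lemma tendsto_iff (hv : ∀ n : ℕ, v n ≤ 1) {ι : Type*} {l : Filter ι}
    {f : ι → AffineAnalyticLine v} {μ : AffineAnalyticLine v} :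
    Tendsto f l (𝓝 μ) ↔ ∀ p, Tendsto (fun i => val hv (f i) p) l (𝓝 (val hv μ p)) := by
  rw [nhds_eq hv, tendsto_iInf]
  simp only [tendsto_comap_iff]
  rfl

lemma continuous_iff (hv : ∀ n : ℕ, v n ≤ 1) {Y : Type*} [TopologicalSpace Y]
    {f : Y → AffineAnalyticLine v} : Continuous f ↔ ∀ p, Continuous fun y => val hv (f y) p := by
  simp only [continuous_iff_continuousAt, ContinuousAt, tendsto_iff hv]
  exact forall_comm

lemma continuous_val (hv : ∀ n : ℕ, v n ≤ 1) (p : S[X]) :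
    Continuous fun μ : AffineAnalyticLine v => val hv μ p :=
  (continuous_iff hv).1 continuous_id p

end

end AffineAnalyticLine

/-! ### Factorization into linear polynomials over the valuation ring -/

section Linear

variable {R : Type*} [CommRing R] {K : Type*} [Field K] [Algebra R K] {w : Valuation K ℝ≥0}

/-- A root `α` of `f` of value greater than `1` still gives a linear factor `1 - α⁻¹ X` over the
valuation ring: the coefficients of the cofactor are computed recursively from those of `f`. -/
lemma exists_eq_linear_mul [IsAlgClosed K] (hw : w.Integers R) (f : R[X]) (hf : f.natDegree ≠ 0) :
    ∃ a b g, f = (C a * X + C b) * g ∧ g.natDegree < f.natDegree := by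
  have hinj := hw.hom_inj
  have : IsDomain R := hinj.isDomain _
  have hdeg : (f.map (algebraMap R K)).natDegree = f.natDegree :=
    natDegree_map_eq_of_injective hinj f
  obtain ⟨α, hα⟩ := IsAlgClosed.exists_root (f.map (algebraMap R K)) (by
    intro h
    exact hf (by rw [← hdeg]; exact natDegree_eq_of_degree_eq_some h))
  have hf0 : f ≠ 0 := by rintro rfl; simp at hf
  rcases le_or_gt (w α) 1 with h1 | h1
  · obtain ⟨a, rfl⟩ := hw.exists_of_le_one h1
    have hroot : f.IsRoot a := by
      rw [IsRoot, eval_map_algebraMap, aeval_algebraMap_apply] at hα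
      exact (map_eq_zero_iff _ hinj).1 hα
    refine ⟨1, -a, f /ₘ (X - C a), ?_, ?_⟩
    · rw [C_1, one_mul, C_neg, ← sub_eq_add_neg]
      exact (mul_divByMonic_eq_iff_isRoot.2 hroot).symm
    · rw [natDegree_divByMonic _ (monic_X_sub_C a), natDegree_X_sub_C]
      omega
  · have hα0 : α ≠ 0 := by rintro rfl; simp at h1
    obtain ⟨b, hb⟩ := hw.exists_of_le_one (r := α⁻¹) (by
      rw [map_inv₀]; exact inv_le_one_of_one_le₀ h1.le)
    obtain ⟨h, hh⟩ := dvd_iff_isRoot.2 hα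
    set k : K[X] := C (-α) * h with hk
    have hfk : f.map (algebraMap R K) = (1 - C (algebraMap R K b) * X) * k := by
      have hC : (C α⁻¹ * C α : K[X]) = 1 := by rw [← C_mul, inv_mul_cancel₀ hα0, C_1]
      rw [hh, hk, hb, C_neg]
      linear_combination (-X * h) * hC
    have hlift : k ∈ lifts (algebraMap R K) := by
      rw [lifts_iff_coeff_lifts]
      intro n
      induction n with
      | zero =>
        refine ⟨f.coeff 0, ?_⟩
        rw [← coeff_map, hfk]
        simp [sub_mul, mul_assoc]
      | succ n ih =>
        obtain ⟨c, hc⟩ := ih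
        refine ⟨f.coeff (n + 1) + b * c, ?_⟩
        rw [map_add, map_mul, hc, ← coeff_map, hfk]
        simp [sub_mul, mul_assoc]
    obtain ⟨g, hg⟩ := (mem_lifts k).1 hlift
    refine ⟨-b, 1, g, ?_, ?_⟩
    · apply map_injective _ hinj
      rw [hfk, ← hg]
      simp only [Polynomial.map_mul, Polynomial.map_add, Polynomial.map_neg, Polynomial.map_one,
        map_C, map_X, C_neg, C_1]
      ring
    · have hb0 : algebraMap R K b ≠ 0 := by rw [hb]; exact inv_ne_zero hα0
      have hk0 : k ≠ 0 := by
        rintro h0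
        rw [h0, mul_zero] at hfk
        exact hf0 ((Polynomial.map_eq_zero_iff hinj).1 hfk)
      rw [← natDegree_map_eq_of_injective hinj g, hg, ← hdeg, hh, hk,
        natDegree_C_mul (neg_ne_zero.2 hα0), natDegree_mul (X_sub_C_ne_zero α),
        natDegree_X_sub_C]
      · omega
      · rintro rfl
        simp [hk] at hk0

/-- Every polynomial over a valuation ring with algebraically closed field of fractions is a product
of polynomials of degree at most `1`. -/
lemma linear_induction [IsAlgClosed K] (hw : w.Integers R) {P : R[X] → Prop}
    (hlin : ∀ a b, P (C a * X + C b)) (hmul : ∀ f g, P f → P g → P (f * g)) (f : R[X]) : P f := by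
  induction hn : f.natDegree using Nat.strong_induction_on generalizing f with
  | _ n ih =>
    by_cases h0 : f.natDegree = 0
    · rw [eq_C_of_natDegree_eq_zero h0]
      simpa using hlin 0 (f.coeff 0)
    · obtain ⟨a, b, g, hfg, hg⟩ := exists_eq_linear_mul hw f h0
      rw [hfg]
      exact hmul _ _ (hlin a b) (ih _ (hn ▸ hg) g rfl)

lemma Valuation.ext_linear [IsAlgClosed K] (hw : w.Integers R) {M N : Valuation R[X] ℝ≥0}
    (h : ∀ a b, M (C a * X + C b) = N (C a * X + C b)) : M = N :=
  Valuation.ext fun f => linear_induction hw (P := fun f => M f = N f) h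
    (fun f g hf hg => by rw [map_mul, map_mul, hf, hg]) f

end Linear

namespace AffineAnalyticLine

section

variable {R : Type*} [CommRing R] {K : Type*} [Field K] [IsAlgClosed K] [Algebra R K]
  {w : Valuation K ℝ≥0} {v : AbsoluteValue R ℝ}

/-! ### The topology in terms of linear polynomials -/

lemma tendsto_iff_linear (hw : w.Integers R) (hv : ∀ n : ℕ, v n ≤ 1) {ι : Type*} {l : Filter ι}
    {f : ι → AffineAnalyticLine v} {μ : AffineAnalyticLine v} :
    Tendsto f l (𝓝 μ) ↔ ∀ a b, Tendsto (fun i => val hv (f i) (C a * X + C b)) l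
      (𝓝 (val hv μ (C a * X + C b))) := by
  rw [tendsto_iff hv]
  refine ⟨fun h a b => h _, fun h => linear_induction hw h fun f g hf hg => ?_⟩
  simpa only [map_mul] using hf.mul hg

lemma nhds_eq_linear (hw : w.Integers R) (hv : ∀ n : ℕ, v n ≤ 1) (μ : AffineAnalyticLine v) :
    𝓝 μ = ⨅ x : R × R, comap (fun ν => val hv ν (C x.1 * X + C x.2))
      (𝓝 (val hv μ (C x.1 * X + C x.2))) := by
  apply le_antisymm
  · refine le_iInf fun x => ?_
    rw [nhds_eq hv]
    exact iInf_le _ _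
  · rw [← tendsto_id', tendsto_iff_linear hw hv]
    intro a b
    exact tendsto_comap.mono_left (iInf_le _ (a, b))

/-- A set of points that contains every point whose values at linear polynomials lie between those
of two of its members. -/
def LinearlyConvex (hv : ∀ n : ℕ, v n ≤ 1) (U : Set (AffineAnalyticLine v)) : Prop :=
  ∀ x ∈ U, ∀ y ∈ U, ∀ z, (∀ a b, val hv x (C a * X + C b) ≤ val hv z (C a * X + C b) ∧
    val hv z (C a * X + C b) ≤ val hv y (C a * X + C b)) → z ∈ U

lemma exists_linearlyConvex (hw : w.Integers R) (hv : ∀ n : ℕ, v n ≤ 1) {μ : AffineAnalyticLine v}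
    {O : Set (AffineAnalyticLine v)} (hO : O ∈ 𝓝 μ) :
    ∃ U ∈ 𝓝 μ, U ⊆ O ∧ LinearlyConvex hv U := by
  rw [nhds_eq_linear hw hv, mem_iInf'] at hO
  obtain ⟨J, hJ, V, hV, -, hOV, -⟩ := hO
  have key : ∀ x : R × R, ∃ s ∈ 𝓝 (val hv μ (C x.1 * X + C x.2)), s.OrdConnected ∧
      (fun ν => val hv ν (C x.1 * X + C x.2)) ⁻¹' s ⊆ V x := by
    intro x
    obtain ⟨t, ht, htV⟩ := mem_comap.1 (hV x)
    exact ⟨Set.ordConnectedComponent t _, Set.ordConnectedComponent_mem_nhds.2 ht, inferInstance,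
      (Set.preimage_mono Set.ordConnectedComponent_subset).trans htV⟩
  choose s hs hsc hsV using key
  refine ⟨⋂ x ∈ J, (fun ν => val hv ν (C x.1 * X + C x.2)) ⁻¹' s x, ?_, ?_, ?_⟩
  · exact (biInter_mem hJ).2 fun x _ => (continuous_val hv _).continuousAt (hs x)
  · rw [hOV]
    exact Set.iInter₂_mono fun x _ => hsV x
  · intro y hy z hz u hu
    simp only [Set.mem_iInter₂, Set.mem_preimage] at hy hz ⊢
    exact fun x hx => (hsc x).out (hy x hx) (hz x hx) (hu x.1 x.2)

end

end AffineAnalyticLine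

/-! ### Valuations on the base ring -/

section Base

/-- The power `N ^ s` of a valuation, for a positive real exponent `s`. -/
noncomputable def powVal {S : Type*} [CommRing S] (N : Valuation S ℝ≥0) (s : ℝ) (hs : 0 < s) :
    Valuation S ℝ≥0 where
  toFun x := N x ^ s
  map_zero' := by simp [hs.ne']
  map_one' := by simp
  map_mul' x y := by rw [map_mul, NNReal.mul_rpow]
  map_add_le_max' x y := by
    rw [← (NNReal.monotone_rpow_of_nonneg hs.le).map_max]
    exact NNReal.monotone_rpow_of_nonneg hs.le (N.map_add x y)

@[simp]
lemma powVal_apply {S : Type*} [CommRing S] (N : Valuation S ℝ≥0) (s : ℝ) (hs : 0 < s) (x : S) :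
    powVal N s hs x = N x ^ s := rfl

variable {R : Type*} [CommRing R] {K : Type*} [Field K] [Algebra R K] {w : Valuation K ℝ≥0}

/-- The valuation on `R` induced by the trivial valuation of the residue field: it is `0` on the
maximal ideal and `1` on units. -/
noncomputable def resVal (hw : w.Integers R) : Valuation R ℝ≥0 where
  toFun x := if w (algebraMap R K x) < 1 then 0 else 1
  map_zero' := by simp
  map_one' := by simp
  map_mul' x y := by
    have hx := hw.map_le_one x
    have hy := hw.map_le_one y
    have hxy : w (algebraMap R K x) * w (algebraMap R K y) < 1 ↔
        w (algebraMap R K x) < 1 ∨ w (algebraMap R K y) < 1 := by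
      constructor
      · intro h
        by_contra! h'
        exact absurd h (by rw [le_antisymm hx h'.1, le_antisymm hy h'.2]; simp)
      · rintro (h | h)
        · exact (mul_le_of_le_one_right zero_le hy).trans_lt h
        · exact (mul_le_of_le_one_left zero_le hx).trans_lt h
    simp only [map_mul, hxy]
    split_ifs <;> simp_all
  map_add_le_max' x y := by
    have h := w.map_add (algebraMap R K x) (algebraMap R K y)
    rw [← map_add] at h
    split_ifs with h1 h2 h3 h3 <;> simp
    exact h1 (h.trans_lt (max_lt ‹_› ‹_›))

lemma resVal_of_lt (hw : w.Integers R) {x : R} (h : w (algebraMap R K x) < 1) : resVal hw x = 0 :=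
  if_pos h

lemma resVal_of_eq (hw : w.Integers R) {x : R} (h : w (algebraMap R K x) = 1) : resVal hw x = 1 :=
  if_neg (by simp [h])

lemma resVal_le (hw : w.Integers R) (x : R) : resVal hw x ≤ w (algebraMap R K x) := by
  rcases (hw.map_le_one x).lt_or_eq with h | h
  · simp [resVal_of_lt hw h]
  · rw [resVal_of_eq hw h, h]

variable {N : Valuation R ℝ≥0}

lemma contractive_apply_eq_one (hw : w.Integers R) (hN : ∀ x, N x ≤ w (algebraMap R K x)) {x : R}
    (hx : w (algebraMap R K x) = 1) : N x = 1 := by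
  obtain ⟨y, hy⟩ := hw.dvd_of_le (x := 1) (y := x) (by simp [hx])
  have hle : ∀ z, N z ≤ 1 := fun z => (hN z).trans (hw.map_le_one z)
  refine le_antisymm (hle x) ?_
  rw [← N.map_one, hy, map_mul]
  exact mul_le_of_le_one_right zero_le (hle y)

lemma contractive_apply_le_apply (hw : w.Integers R) (hN : ∀ x, N x ≤ w (algebraMap R K x))
    {x y : R} (h : w (algebraMap R K x) ≤ w (algebraMap R K y)) : N x ≤ N y := by
  obtain ⟨z, rfl⟩ := hw.dvd_of_le h
  rw [map_mul]
  exact mul_le_of_le_one_right zero_le ((hN z).trans (hw.map_le_one z))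

lemma contractive_eq_resVal (hw : w.Integers R) (hN : ∀ x, N x ≤ w (algebraMap R K x)) {ϖ : R}
    (hϖ0 : 0 < w (algebraMap R K ϖ)) (hϖ : N ϖ = 0) : N = resVal hw := by
  refine Valuation.ext fun x => ?_
  rcases (hw.map_le_one x).lt_or_eq with h | h
  · rw [resVal_of_lt hw h]
    obtain ⟨n, hn⟩ := exists_pow_lt_of_lt_one hϖ0 h
    have := contractive_apply_le_apply hw hN (x := x ^ n) (y := ϖ) (by simpa using hn.le)
    rw [hϖ, map_pow] at this
    exact eq_zero_of_pow_eq_zero (le_zero_iff.1 this)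
  · rw [resVal_of_eq hw h, contractive_apply_eq_one hw hN h]

lemma exists_nat_mul_btwn {α β : ℝ} (hα : 0 ≤ α) (h : α < β) :
    ∃ m n : ℕ, m * α < n ∧ n < m * β := by
  obtain ⟨m, hm⟩ := exists_nat_gt (β - α)⁻¹
  have hd : 0 < β - α := sub_pos.2 h
  have h1 : 1 < m * (β - α) := by
    rwa [inv_eq_one_div, div_lt_iff₀ hd] at hm
  refine ⟨m, ⌊m * α⌋₊ + 1, by exact_mod_cast Nat.lt_floor_add_one _, ?_⟩
  have := Nat.floor_le (mul_nonneg (Nat.cast_nonneg (α := ℝ) m) hα)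
  push_cast
  linarith

/-- A nonzero contractive valuation on a valuation ring of rank one is a power of the given one.
The exponents of `x` relative to `ϖ` for the two valuations agree, since they compare in the same
way with every fraction. -/
lemma contractive_eq_rpow (hw : w.Integers R) (hN : ∀ x, N x ≤ w (algebraMap R K x)) {ϖ : R}
    (hϖ0 : 0 < w (algebraMap R K ϖ)) (hϖ1 : w (algebraMap R K ϖ) < 1) (hϖ : N ϖ ≠ 0) :
    1 ≤ Real.log (N ϖ) / Real.log (w (algebraMap R K ϖ)) ∧
    ∀ x, N x = w (algebraMap R K x) ^ (Real.log (N ϖ) / Real.log (w (algebraMap R K ϖ))) := by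
  have hNϖ : 0 < N ϖ := pos_iff_ne_zero.2 hϖ
  have hlw : Real.log (w (algebraMap R K ϖ)) < 0 :=
    Real.log_neg (by exact_mod_cast hϖ0) (by exact_mod_cast hϖ1)
  have hlN : Real.log (N ϖ) ≤ Real.log (w (algebraMap R K ϖ)) :=
    Real.log_le_log (by exact_mod_cast hNϖ) (by exact_mod_cast hN ϖ)
  have hlN0 : Real.log (N ϖ) < 0 := hlN.trans_lt hlw
  have h1 : 1 ≤ Real.log (N ϖ) / Real.log (w (algebraMap R K ϖ)) := (one_le_div_of_neg hlw).2 hlN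
  refine ⟨h1, fun x => ?_⟩
  rcases eq_or_ne x 0 with rfl | hx
  · simp only [map_zero]
    rw [NNReal.zero_rpow (by linarith)]
  have hwx : 0 < w (algebraMap R K x) :=
    pos_iff_ne_zero.2 (w.ne_zero_iff.2 ((map_ne_zero_iff _ hw.hom_inj).2 hx))
  have hNx : 0 < N x := by
    obtain ⟨n, hn⟩ := exists_pow_lt_of_lt_one hwx hϖ1
    have := contractive_apply_le_apply hw hN (x := ϖ ^ n) (y := x) (by simpa using hn.le)
    rw [map_pow] at this
    exact (pow_pos hNϖ n).trans_le this
  set α := Real.log (w (algebraMap R K x)) / Real.log (w (algebraMap R K ϖ)) with hα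
  set β := Real.log (N x) / Real.log (N ϖ) with hβ
  have hα0 : 0 ≤ α := div_nonneg_of_nonpos
    (Real.log_nonpos (NNReal.coe_nonneg _) (by exact_mod_cast hw.map_le_one x)) hlw.le
  have hβ0 : 0 ≤ β := div_nonneg_of_nonpos
    (Real.log_nonpos (NNReal.coe_nonneg _)
      (by exact_mod_cast (hN x).trans (hw.map_le_one x))) hlN0.le
  have hpow : ∀ {y z : ℝ≥0}, 0 < y → 0 < z → ∀ m n : ℕ,
      (y ^ m ≤ z ^ n ↔ m * Real.log y ≤ n * Real.log z) := by
    intro y z hy hz m n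
    rw [← Real.log_pow, ← Real.log_pow, Real.log_le_log_iff
      (pow_pos (by exact_mod_cast hy) _) (pow_pos (by exact_mod_cast hz) _)]
    norm_cast
  have hwα : Real.log (w (algebraMap R K x)) = α * Real.log (w (algebraMap R K ϖ)) :=
    (div_mul_cancel₀ _ hlw.ne).symm
  have hNβ : Real.log (N x) = β * Real.log (N ϖ) := (div_mul_cancel₀ _ hlN0.ne).symm
  have hαβ : α = β := by
    by_contra hne
    rcases lt_or_gt_of_ne hne with hlt | hlt
    · obtain ⟨m, n, hq1, hq2⟩ := exists_nat_mul_btwn hα0 hlt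
      have h2 := contractive_apply_le_apply hw hN (x := ϖ ^ n) (y := x ^ m) (by
        rw [map_pow, map_pow, map_pow, map_pow, hpow hϖ0 hwx, hwα]
        nlinarith)
      rw [map_pow, map_pow, hpow hNϖ hNx, hNβ] at h2
      nlinarith
    · obtain ⟨m, n, hq1, hq2⟩ := exists_nat_mul_btwn hβ0 hlt
      have h2 := contractive_apply_le_apply hw hN (x := x ^ m) (y := ϖ ^ n) (by
        rw [map_pow, map_pow, map_pow, map_pow, hpow hwx hϖ0, hwα]
        nlinarith)
      rw [map_pow, map_pow, hpow hNx hNϖ, hNβ] at h2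
      nlinarith
  rw [← NNReal.coe_inj, NNReal.coe_rpow, Real.rpow_def_of_pos (by exact_mod_cast hwx), hwα, hαβ]
  have : β * Real.log (w (algebraMap R K ϖ)) *
      (Real.log (N ϖ) / Real.log (w (algebraMap R K ϖ))) = Real.log (N x) := by
    rw [hNβ]; field_simp [hlw.ne]
  rw [this, Real.exp_log (by exact_mod_cast hNx)]

/-- The path of valuations `N ^ (1 / u)`, which degenerates to the trivial valuation of the residue
field at `u = 0`. -/
noncomputable def degenVal (hw : w.Integers R) (N : Valuation R ℝ≥0) (u : I) : Valuation R ℝ≥0 :=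
  if h : 0 < u then powVal N (u : ℝ)⁻¹ (inv_pos.2 h) else resVal hw

lemma degenVal_zero (hw : w.Integers R) : degenVal hw N 0 = resVal hw := by simp [degenVal]

lemma degenVal_one (hw : w.Integers R) : degenVal hw N 1 = N := by
  refine Valuation.ext fun x => ?_
  simp [degenVal]

lemma degenVal_of_lt (hw : w.Integers R) {x : R} (hx : w (algebraMap R K x) < 1) (u : I) :
    degenVal hw N u x = if 0 < u then N x ^ (u : ℝ)⁻¹ else 0 := by
  unfold degenVal
  split_ifs with h
  · rfl
  · exact resVal_of_lt hw hx

lemma degenVal_of_eq (hw : w.Integers R) (hN : ∀ x, N x ≤ w (algebraMap R K x)) {x : R}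
    (hx : w (algebraMap R K x) = 1) (u : I) : degenVal hw N u x = 1 := by
  unfold degenVal
  split_ifs with h
  · simp [contractive_apply_eq_one hw hN hx]
  · exact resVal_of_eq hw hx

lemma degenVal_mono (hw : w.Integers R) (hN : ∀ x, N x ≤ w (algebraMap R K x)) (x : R) :
    Monotone fun u => degenVal hw N u x := by
  intro u u' huu'
  rcases (hw.map_le_one x).lt_or_eq with h | h
  · simp only [degenVal_of_lt hw h]
    split_ifs with h1 h2 h2
    · rw [← NNReal.coe_le_coe, NNReal.coe_rpow, NNReal.coe_rpow]
      exact Real.rpow_le_rpow_of_exponent_ge' (NNReal.coe_nonneg _)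
        (by exact_mod_cast (hN x).trans (hw.map_le_one x)) (inv_nonneg.2 u'.2.1)
        (inv_anti₀ h1 huu')
    · exact absurd (h1.trans_le huu') h2
    · exact zero_le
    · exact le_rfl
  · simp only [degenVal_of_eq hw hN h, le_refl]

lemma degenVal_le (hw : w.Integers R) (hN : ∀ x, N x ≤ w (algebraMap R K x)) (u : I) (x : R) :
    degenVal hw N u x ≤ w (algebraMap R K x) := by
  refine (degenVal_mono hw hN x (le_one' : u ≤ 1)).trans ?_
  simpa [degenVal_one] using hN x

lemma continuous_degenVal (hw : w.Integers R) (hN : ∀ x, N x ≤ w (algebraMap R K x)) (x : R) :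
    Continuous fun u => degenVal hw N u x := by
  rcases (hw.map_le_one x).lt_or_eq with h | h
  · simp only [degenVal_of_lt hw h]
    have hlt : N x < 1 := (hN x).trans_lt h
    rw [continuous_iff_continuousAt]
    intro u
    rcases (unitInterval.nonneg' : (0 : I) ≤ u).eq_or_lt with rfl | hu
    · have h1 : Tendsto (fun t : ℝ => if 0 < t then N x ^ t⁻¹ else 0) (𝓝[≥] 0) (𝓝 0) := by
        rw [← Set.Ioi_insert, nhdsWithin_insert, tendsto_sup]
        constructor
        · rw [tendsto_pure_left]
          intro s hs
          simpa using mem_of_mem_nhds hs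
        · refine Tendsto.congr' (f₁ := fun t : ℝ => N x ^ t⁻¹) ?_ ?_
          · filter_upwards [self_mem_nhdsWithin] with t ht
            rw [if_pos (Set.mem_Ioi.1 ht)]
          · rw [← NNReal.tendsto_coe]
            simp only [NNReal.coe_rpow]
            exact (tendsto_rpow_atTop_of_base_lt_one _
              (by linarith [NNReal.coe_nonneg (N x)]) (by exact_mod_cast hlt)).comp
              tendsto_inv_nhdsGT_zero
      have h2 : Tendsto (fun u : I => (u : ℝ)) (𝓝 0) (𝓝[≥] 0) :=
        tendsto_nhdsWithin_iff.2 ⟨continuous_subtype_val.tendsto' _ _ rfl,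
          Eventually.of_forall fun u => u.2.1⟩
      have h3 := h1.comp h2
      rw [ContinuousAt]
      simpa [Function.comp_def] using h3
    · have : ContinuousAt (fun u : I => N x ^ (u : ℝ)⁻¹) u := by
        have hc : ContinuousAt (fun u : I => (u : ℝ)⁻¹) u :=
          continuous_subtype_val.continuousAt.inv₀ (ne_of_gt hu)
        exact NNReal.continuousAt_rpow (Or.inr (inv_pos.2 hu)) |>.comp
          (f := fun u : I => (N x, (u : ℝ)⁻¹)) (continuousAt_const.prodMk hc)
      refine this.congr ?_
      filter_upwards [lt_mem_nhds hu] with t ht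
      rw [if_pos ht]
  · simp only [degenVal_of_eq hw hN h]
    exact continuous_const

end Base

/-! ### Disc seminorms -/

namespace AffineAnalyticLine

section

variable {R : Type*} [CommRing R] {K : Type*} [Field K] [Algebra R K]
  {w : Valuation K ℝ≥0} {v : AbsoluteValue R ℝ} {S : Type*} [CommRing S] [Algebra R S]

/-- The point of the affine line over `R` given by the disc of radius `r` and centre `c`. -/
noncomputable def disc (N : Valuation S ℝ≥0) (hN : ∀ a : R, (N (algebraMap R S a) : ℝ) ≤ v a)
    (r : ℝ≥0) (c : S) : AffineAnalyticLine v :=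
  ofVal (discVal R N r c) fun a => by simpa using hN a

lemma val_disc_linear (hv : ∀ n : ℕ, v n ≤ 1) (N : Valuation S ℝ≥0)
    (hN : ∀ a : R, (N (algebraMap R S a) : ℝ) ≤ v a) (r : ℝ≥0) (c : S) (a b : R) :
    val hv (disc N hN r c) (C a * X + C b) =
      max (N (algebraMap R S a) * r) (N (algebraMap R S a * c + algebraMap R S b)) := by
  simp [disc]

lemma tendsto_disc (hv : ∀ n : ℕ, v n ≤ 1) {ι : Type*} {l : Filter ι} {N : ι → Valuation S ℝ≥0}
    {N₀ : Valuation S ℝ≥0} {r : ι → ℝ≥0} {r₀ : ℝ≥0}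
    (hN : ∀ i, ∀ a : R, (N i (algebraMap R S a) : ℝ) ≤ v a)
    (hN₀ : ∀ a : R, (N₀ (algebraMap R S a) : ℝ) ≤ v a)
    (hlim : ∀ x, Tendsto (fun i => N i x) l (𝓝 (N₀ x))) (hr : Tendsto r l (𝓝 r₀)) (c : S) :
    Tendsto (fun i => disc (N i) (hN i) (r i) c) l (𝓝 (disc N₀ hN₀ r₀ c)) := by
  rw [tendsto_iff hv]
  intro p
  simpa [disc] using tendsto_discVal hlim hr c p

lemma continuous_disc (hv : ∀ n : ℕ, v n ≤ 1) {Y : Type*} [TopologicalSpace Y]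
    {N : Y → Valuation S ℝ≥0} {r : Y → ℝ≥0}
    (hN : ∀ y, ∀ a : R, (N y (algebraMap R S a) : ℝ) ≤ v a)
    (hc : ∀ x, Continuous fun y => N y x) (hr : Continuous r) (c : S) :
    Continuous fun y => disc (N y) (hN y) (r y) c :=
  continuous_iff_continuousAt.2 fun y => tendsto_disc hv hN (hN y)
    (fun x => (hc x).continuousAt) hr.continuousAt c

/-- The point obtained from `μ` by raising all radii to at least `r`. It is the disc seminorm over
`(R[X], μ)` with the tautological centre `X`, i.e. `f ↦ max_i μ (f⁽ⁱ⁾ / i!) r ^ i`. -/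
noncomputable def raise (hv : ∀ n : ℕ, v n ≤ 1) (μ : AffineAnalyticLine v) (r : ℝ≥0) :
    AffineAnalyticLine v :=
  disc (val hv μ) (fun a => val_C_le hv μ a) r X

lemma val_raise_linear (hv : ∀ n : ℕ, v n ≤ 1) (μ : AffineAnalyticLine v) (r : ℝ≥0) (a b : R) :
    val hv (raise hv μ r) (C a * X + C b) =
      max (val hv μ (C a) * r) (val hv μ (C a * X + C b)) := by
  rw [raise, val_disc_linear]
  rfl

lemma natCast_le_one (hw : w.Integers R) (hvw : ∀ x, v x = w (algebraMap R K x)) (n : ℕ) :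
    v n ≤ 1 := by
  rw [hvw]
  exact NNReal.coe_le_one.2 (hw.map_le_one _)

lemma coe_le_of_le (hvw : ∀ x, v x = w (algebraMap R K x)) {N : Valuation R ℝ≥0}
    (hN : ∀ x, N x ≤ w (algebraMap R K x)) (a : R) : (N (algebraMap R R a) : ℝ) ≤ v a := by
  rw [hvw]
  exact_mod_cast hN a

lemma val_C_le_val (hvw : ∀ x, v x = w (algebraMap R K x)) (hv : ∀ n : ℕ, v n ≤ 1)
    (μ : AffineAnalyticLine v) (x : R) : (val hv μ).comap C x ≤ w (algebraMap R K x) := by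
  have := val_C_le hv μ x
  rw [hvw] at this
  exact_mod_cast this

/-! ### Paths -/

lemma LinearlyConvex.joinedIn {hv : ∀ n : ℕ, v n ≤ 1} {U : Set (AffineAnalyticLine v)}
    (hU : LinearlyConvex hv U) {F : I → AffineAnalyticLine v} (hF : Continuous F)
    (hmono : ∀ a b, Monotone fun t => val hv (F t) (C a * X + C b)) (h0 : F 0 ∈ U) (h1 : F 1 ∈ U) :
    JoinedIn U (F 0) (F 1) :=
  ⟨⟨⟨F, hF⟩, rfl, rfl⟩, fun _ => hU _ h0 _ h1 _ fun a b =>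
    ⟨hmono a b unitInterval.nonneg', hmono a b unitInterval.le_one'⟩⟩

lemma LinearlyConvex.joinedIn_disc_of_le {hv : ∀ n : ℕ, v n ≤ 1}
    {U : Set (AffineAnalyticLine v)} (hU : LinearlyConvex hv U) {N : Valuation S ℝ≥0}
    {hN : ∀ a : R, (N (algebraMap R S a) : ℝ) ≤ v a} {r r' : ℝ≥0} (hrr' : r ≤ r') {c : S}
    (h : disc N hN r c ∈ U) (h' : disc N hN r' c ∈ U) :
    JoinedIn U (disc N hN r c) (disc N hN r' c) := by
  have h2 : r + (r' - r) = r' := add_tsub_cancel_of_le hrr'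
  have h := hU.joinedIn
    (F := fun t => disc N hN (r + unitInterval.toNNReal t * (r' - r)) c) ?_ ?_ ?_ ?_
  · simpa [h2] using h
  · exact continuous_disc hv _ (fun x => continuous_const)
      (continuous_const.add (unitInterval.toNNReal_continuous.mul continuous_const)) c
  · intro a b t t' htt'
    have : unitInterval.toNNReal t ≤ unitInterval.toNNReal t' := htt'
    simp only [val_disc_linear]
    gcongr
  · simpa using h
  · simpa [h2] using h'

lemma LinearlyConvex.joinedIn_disc {hv : ∀ n : ℕ, v n ≤ 1}
    {U : Set (AffineAnalyticLine v)} (hU : LinearlyConvex hv U) {N : Valuation S ℝ≥0}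
    {hN : ∀ a : R, (N (algebraMap R S a) : ℝ) ≤ v a} {r r' : ℝ≥0} {c : S}
    (h : disc N hN r c ∈ U) (h' : disc N hN r' c ∈ U) :
    JoinedIn U (disc N hN r c) (disc N hN r' c) :=
  (le_total r r').elim (fun hle => hU.joinedIn_disc_of_le hle h h')
    fun hle => (hU.joinedIn_disc_of_le hle h' h).symm

lemma LinearlyConvex.joinedIn_degen (hw : w.Integers R)
    (hvw : ∀ x, v x = w (algebraMap R K x)) {hv : ∀ n : ℕ, v n ≤ 1}
    {U : Set (AffineAnalyticLine v)} (hU : LinearlyConvex hv U) {N : Valuation R ℝ≥0}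
    (hN : ∀ x, N x ≤ w (algebraMap R K x)) {r : ℝ≥0} {c : R}
    (h0 : disc (resVal hw) (coe_le_of_le hvw (resVal_le hw)) r c ∈ U)
    (h1 : disc N (coe_le_of_le hvw hN) r c ∈ U) :
    JoinedIn U (disc (resVal hw) (coe_le_of_le hvw (resVal_le hw)) r c)
      (disc N (coe_le_of_le hvw hN) r c) := by
  have h := hU.joinedIn (F := fun t => disc (degenVal hw N t)
    (coe_le_of_le hvw (degenVal_le hw hN t)) r c) ?_ ?_ ?_ ?_
  · simpa [degenVal_zero, degenVal_one] using h
  · exact continuous_disc hv _ (continuous_degenVal hw hN) continuous_const c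
  · intro a b t t' htt'
    simp only [val_disc_linear]
    gcongr <;> exact degenVal_mono hw hN _ htt'
  · simpa [degenVal_zero] using h0
  · simpa [degenVal_one] using h1

variable [IsAlgClosed K]

/-! ### Raising the radius of a point -/

lemma ext_linear (hw : w.Integers R) (hv : ∀ n : ℕ, v n ≤ 1) {μ ν : AffineAnalyticLine v}
    (h : ∀ a b, val hv μ (C a * X + C b) = val hv ν (C a * X + C b)) : μ = ν :=
  val_injective hv (Valuation.ext_linear hw h)

lemma raise_zero (hw : w.Integers R) (hv : ∀ n : ℕ, v n ≤ 1) (μ : AffineAnalyticLine v) :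
    raise hv μ 0 = μ :=
  ext_linear hw hv fun a b => by simp [val_raise_linear]

lemma tendsto_raise (hv : ∀ n : ℕ, v n ≤ 1) {ι : Type*} {l : Filter ι}
    {f : ι → AffineAnalyticLine v} {μ : AffineAnalyticLine v} {r : ι → ℝ≥0} {r₀ : ℝ≥0}
    (hf : Tendsto f l (𝓝 μ)) (hr : Tendsto r l (𝓝 r₀)) :
    Tendsto (fun i => raise hv (f i) (r i)) l (𝓝 (raise hv μ r₀)) :=
  tendsto_disc hv _ _ ((tendsto_iff hv).1 hf) hr X

/-- Once the radius reaches the value of `μ` at `X - c`, with `c = -p / q`, raising `μ` gives the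
disc of centre `c`. -/
lemma raise_eq_disc (hw : w.Integers R) (hv : ∀ n : ℕ, v n ≤ 1) (μ : AffineAnalyticLine v)
    (N : Valuation S ℝ≥0) (hN : ∀ a : R, (N (algebraMap R S a) : ℝ) ≤ v a)
    (hNμ : ∀ a, N (algebraMap R S a) = val hv μ (C a)) {c : S} {p q : R}
    (hc : algebraMap R S q * c + algebraMap R S p = 0) (hq : val hv μ (C q) ≠ 0) :
    raise hv μ (val hv μ (C q * X + C p) / val hv μ (C q)) =
      disc N hN (val hv μ (C q * X + C p) / val hv μ (C q)) c := by
  refine ext_linear hw hv fun a b => ?_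
  rw [val_raise_linear, val_disc_linear, hNμ]
  set M := val hv μ
  have hqpos : 0 < M (C q) := pos_iff_ne_zero.2 hq
  refine mul_left_cancel₀ hq ?_
  rw [mul_max_of_nonneg _ _ zero_le, mul_max_of_nonneg _ _ zero_le]
  have h1 : M (C q) * (M (C a) * (M (C q * X + C p) / M (C q))) =
      M (C a * (C q * X + C p)) := by
    rw [map_mul M (C a)]; field_simp
  have h2 : M (C q) * N (algebraMap R S a * c + algebraMap R S b) = M (C (q * b - a * p)) := by
    rw [← hNμ, ← hNμ, ← map_mul]
    congr 1
    rw [map_sub, map_mul, map_mul]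
    linear_combination algebraMap R S a * hc
  have h3 : M (C q) * M (C a * X + C b) = M (C a * (C q * X + C p) + C (q * b - a * p)) := by
    rw [← map_mul]
    congr 1
    simp only [C_sub, C_mul]
    ring
  rw [h1, h2, h3]
  apply le_antisymm
  · exact max_le (le_max_left _ _) (M.map_add _ _)
  · refine max_le (le_max_left _ _) ?_
    calc M (C (q * b - a * p))
        = M (C a * (C q * X + C p) + C (q * b - a * p) - C a * (C q * X + C p)) := by
          rw [add_sub_cancel_left]
      _ ≤ _ := M.map_sub _ _
      _ = _ := max_comm _ _

/-- Discs of the form `raise μ r`, with `r` the value of `μ` at some `X - c`, approximate `μ`: at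
the infimum of these radii, raising does not change `μ`. -/
lemma exists_raise_mem (hw : w.Integers R) (hv : ∀ n : ℕ, v n ≤ 1) (μ : AffineAnalyticLine v)
    {U : Set (AffineAnalyticLine v)} (hU : U ∈ 𝓝 μ) :
    ∃ p q, val hv μ (C q) ≠ 0 ∧ raise hv μ (val hv μ (C q * X + C p) / val hv μ (C q)) ∈ U := by
  set T : Set ℝ≥0 :=
    {t | ∃ p q, val hv μ (C q) ≠ 0 ∧ t = val hv μ (C q * X + C p) / val hv μ (C q)} with hT
  have hne : T.Nonempty := ⟨_, 0, 1, by simp, rfl⟩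
  have hm : raise hv μ (sInf T) = μ := by
    refine ext_linear hw hv fun a b => ?_
    rw [val_raise_linear, max_eq_right]
    by_cases ha : val hv μ (C a) = 0
    · simp [ha]
    · have h : sInf T ≤ val hv μ (C a * X + C b) / val hv μ (C a) :=
        csInf_le (OrderBot.bddBelow _) ⟨b, a, ha, rfl⟩
      rwa [le_div_iff₀ (pos_iff_ne_zero.2 ha), mul_comm] at h
  have hcont : Tendsto (raise hv μ) (𝓝 (sInf T)) (𝓝 μ) := by
    have := tendsto_raise hv (tendsto_const_nhds (x := μ)) (tendsto_id (x := 𝓝 (sInf T)))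
    rwa [hm] at this
  obtain ⟨t, htU, p, q, hq, rfl⟩ :=
    mem_closure_iff_nhds.1 (csInf_mem_closure hne (OrderBot.bddBelow _)) _ (hcont hU)
  exact ⟨p, q, hq, htU⟩

lemma LinearlyConvex.joinedIn_raise (hw : w.Integers R) {hv : ∀ n : ℕ, v n ≤ 1}
    {U : Set (AffineAnalyticLine v)} (hU : LinearlyConvex hv U) {μ : AffineAnalyticLine v} {r : ℝ≥0}
    (hμ : μ ∈ U) (hr : raise hv μ r ∈ U) : JoinedIn U μ (raise hv μ r) := by
  have h := hU.joinedIn (F := fun t => raise hv μ (unitInterval.toNNReal t * r)) ?_ ?_ ?_ ?_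
  · simpa [raise_zero hw] using h
  · exact continuous_iff_continuousAt.2 fun t => tendsto_raise hv tendsto_const_nhds
      ((unitInterval.toNNReal_continuous.mul continuous_const).tendsto t)
  · intro a b t t' htt'
    have : unitInterval.toNNReal t ≤ unitInterval.toNNReal t' := htt'
    simp only [val_raise_linear]
    gcongr
  · simpa [raise_zero hw] using hμ
  · simpa using hr

theorem pathConnectedSpace (hw : w.Integers R) (hvw : ∀ x, v x = w (algebraMap R K x)) :
    PathConnectedSpace (AffineAnalyticLine v) := by
  have hv := natCast_le_one hw hvw
  have hU : LinearlyConvex hv (Set.univ : Set (AffineAnalyticLine v)) :=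
    fun _ _ _ _ _ _ => Set.mem_univ _
  rw [pathConnectedSpace_iff_univ]
  refine ⟨disc (resVal hw) (coe_le_of_le hvw (resVal_le hw)) 1 0, Set.mem_univ _, fun μ _ => ?_⟩
  have hN := val_C_le_val hvw hv μ
  have h1 := hU.joinedIn_raise hw (Set.mem_univ μ)
    (r := val hv μ (C 1 * X + C 0) / val hv μ (C 1)) (Set.mem_univ _)
  rw [raise_eq_disc hw hv μ ((val hv μ).comap C) (coe_le_of_le hvw hN) (fun _ => rfl) (c := 0)
    (by simp) (by simp)] at h1
  exact (hU.joinedIn_disc (Set.mem_univ _) (Set.mem_univ _)).trans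
    ((hU.joinedIn_degen hw hvw hN (Set.mem_univ _) (Set.mem_univ _)).trans h1.symm)

end

end AffineAnalyticLine

namespace AffineAnalyticLine

section

/-! ### Local path connectedness -/

variable {R : Type*} [CommRing R] {K : Type*} [Field K] [Algebra R K]
  {w : Valuation K ℝ≥0} {v : AbsoluteValue R ℝ}

lemma coe_powVal_le (hw : w.Integers R) (hvw : ∀ x, v x = w (algebraMap R K x)) {s : ℝ}
    (hs : 1 ≤ s) (a : R) : (powVal w s (by linarith) (algebraMap R K a) : ℝ) ≤ v a := by
  rw [hvw, powVal_apply, NNReal.coe_rpow]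
  simpa using Real.rpow_le_rpow_of_exponent_ge' (NNReal.coe_nonneg _)
    (NNReal.coe_le_one.2 (hw.map_le_one a)) zero_le_one hs

variable [IsAlgClosed K]

/-- Near a point of the fibre over the trivial valuation of the residue field, a point is joined to
`μ` by raising its radius, degenerating the base valuation, and lowering the radius. -/
lemma pathComponentIn_mem_nhds_of_eq_zero (hw : w.Integers R)
    (hvw : ∀ x, v x = w (algebraMap R K x)) (hv : ∀ n : ℕ, v n ≤ 1) {ϖ : R}
    (hϖ0 : 0 < w (algebraMap R K ϖ)) {μ : AffineAnalyticLine v}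
    (hμ : val hv μ (C ϖ) = 0) {U : Set (AffineAnalyticLine v)} (hU : U ∈ 𝓝 μ)
    (hconv : LinearlyConvex hv U) : pathComponentIn U μ ∈ 𝓝 μ := by
  obtain ⟨p, q, hq, hmem⟩ := exists_raise_mem hw hv μ (interior_mem_nhds.2 hU)
  have hres : (val hv μ).comap C = resVal hw :=
    contractive_eq_resVal hw (val_C_le_val hvw hv μ) hϖ0 hμ
  have hresC : ∀ a, resVal hw a = val hv μ (C a) := fun a => by rw [← hres]; rfl
  have hq1 : w (algebraMap R K q) = 1 := by
    refine (hw.map_le_one q).lt_or_eq.resolve_left fun h => hq ?_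
    rw [← hresC, resVal_of_lt hw h]
  -- Over the residue field the denominator of the centre `-p / q` is a unit.
  obtain ⟨c, hc⟩ := hw.dvd_of_le (x := -p) (y := q) (by rw [hq1]; exact hw.map_le_one _)
  have hc' : algebraMap R R q * c + algebraMap R R p = 0 := by
    simp [← hc]
  have hνq : ∀ ν, val hv ν (C q) = 1 := fun ν =>
    contractive_apply_eq_one hw (val_C_le_val hvw hv ν) hq1
  set ρ : AffineAnalyticLine v → ℝ≥0 := fun ν => val hv ν (C q * X + C p) / val hv ν (C q) with hρ
  have hρc : Tendsto ρ (𝓝 μ) (𝓝 (ρ μ)) := by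
    simp only [hρ, hνq, div_one]
    exact (continuous_val hv _).tendsto μ
  have hraise : ∀ ν, raise hv ν (ρ ν) =
      disc ((val hv ν).comap C) (coe_le_of_le hvw (val_C_le_val hvw hv ν)) (ρ ν) c := fun ν =>
    raise_eq_disc hw hv ν ((val hv ν).comap C) (coe_le_of_le hvw (val_C_le_val hvw hv ν))
      (fun _ => rfl) hc' (by rw [hνq]; exact one_ne_zero)
  have hraiseμ : raise hv μ (ρ μ) =
      disc (resVal hw) (coe_le_of_le hvw (resVal_le hw)) (ρ μ) c :=
    raise_eq_disc hw hv μ (resVal hw) (coe_le_of_le hvw (resVal_le hw)) hresC hc' hq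
  have hnhds : U ∈ 𝓝 (raise hv μ (ρ μ)) := mem_interior_iff_mem_nhds.1 hmem
  have e1 : ∀ᶠ ν in 𝓝 μ, raise hv ν (ρ ν) ∈ U := tendsto_raise hv tendsto_id hρc hnhds
  have e2 : ∀ᶠ ν in 𝓝 μ, disc (resVal hw) (coe_le_of_le hvw (resVal_le hw)) (ρ ν) c ∈ U := by
    rw [hraiseμ] at hnhds
    exact tendsto_disc hv (fun _ => coe_le_of_le hvw (resVal_le hw)) _
      (fun _ => tendsto_const_nhds) hρc c hnhds
  filter_upwards [hU, e1, e2] with ν h0 h1 h2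
  have j1 := hconv.joinedIn_raise hw h0 h1
  rw [hraise] at j1 h1
  have j2 := hconv.joinedIn_degen hw hvw (val_C_le_val hvw hv ν) h2 h1
  have hμU := mem_of_mem_nhds hnhds
  have j4 := hconv.joinedIn_raise hw (mem_of_mem_nhds hU) hμU
  rw [hraiseμ] at j4 hμU
  exact j4.trans ((hconv.joinedIn_disc hμU h2).trans (j2.trans j1.symm))

/-- Near a point `μ` whose base valuation is a power of the given one, a point is joined to `μ` by
raising its radius to a disc with centre in `K`, moving the exponent and the radius of this disc
within a small ball, and lowering the radius. -/
lemma pathComponentIn_mem_nhds_of_ne_zero (hw : w.Integers R)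
    (hvw : ∀ x, v x = w (algebraMap R K x)) (hv : ∀ n : ℕ, v n ≤ 1) {ϖ : R}
    (hϖ0 : 0 < w (algebraMap R K ϖ)) (hϖ1 : w (algebraMap R K ϖ) < 1) {μ : AffineAnalyticLine v}
    (hμ : val hv μ (C ϖ) ≠ 0) {U : Set (AffineAnalyticLine v)} (hU : U ∈ 𝓝 μ)
    (hconv : LinearlyConvex hv U) : pathComponentIn U μ ∈ 𝓝 μ := by
  obtain ⟨p, q, hq, hmem⟩ := exists_raise_mem hw hv μ (interior_mem_nhds.2 hU)
  set c : K := -(algebraMap R K p / algebraMap R K q)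
  have hq0 : algebraMap R K q ≠ 0 := by
    intro h
    rw [(map_eq_zero_iff _ hw.hom_inj).1 h] at hq
    simp at hq
  have hc : algebraMap R K q * c + algebraMap R K p = 0 := by
    simp only [c]; field_simp; ring
  set ρ : AffineAnalyticLine v → ℝ≥0 := fun ν => val hv ν (C q * X + C p) / val hv ν (C q) with hρ
  set s : AffineAnalyticLine v → ℝ :=
    fun ν => Real.log (val hv ν (C ϖ)) / Real.log (w (algebraMap R K ϖ)) with hs
  have hρc : Tendsto ρ (𝓝 μ) (𝓝 (ρ μ)) :=
    ((continuous_val hv _).tendsto μ).div ((continuous_val hv _).tendsto μ) hq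
  have hsc : Tendsto s (𝓝 μ) (𝓝 (s μ)) := by
    refine Tendsto.div_const (Tendsto.log ?_ (by exact_mod_cast hμ)) _
    exact NNReal.tendsto_coe.2 ((continuous_val hv _).tendsto μ)
  -- The maximum only makes `G` total: at a point `ν` the exponent `s ν` is at least `1`.
  set G : ℝ × ℝ → AffineAnalyticLine v := fun x =>
    disc (powVal w (max x.1 1) (by positivity)) (coe_powVal_le hw hvw (le_max_right _ _))
      x.2.toNNReal c with hG
  have hGc : Continuous G := by
    refine continuous_disc hv _ (fun x => ?_) (continuous_real_toNNReal.comp continuous_snd) c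
    have h1 : Continuous fun y : ℝ × ℝ => max y.1 1 := by fun_prop
    exact continuous_iff_continuousAt.2 fun y =>
      (NNReal.continuousAt_rpow (Or.inr (by positivity))).comp
        (f := fun y : ℝ × ℝ => (w x, max y.1 1)) (continuousAt_const.prodMk h1.continuousAt)
  have hraise : ∀ ν, val hv ν (C ϖ) ≠ 0 → val hv ν (C q) ≠ 0 →
      raise hv ν (ρ ν) = G (s ν, ρ ν) := by
    intro ν h1 h2
    obtain ⟨h3, h4⟩ := contractive_eq_rpow hw (val_C_le_val hvw hv ν) hϖ0 hϖ1 h1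
    change 1 ≤ s ν at h3
    have h5 := raise_eq_disc hw hv ν (powVal w (max (s ν) 1) (by positivity))
      (coe_powVal_le hw hvw (le_max_right _ _)) (fun a => ?_) hc h2
    · simpa [hG] using h5
    · rw [powVal_apply, max_eq_left h3]
      exact (h4 a).symm
  have hmemG : G ⁻¹' U ∈ 𝓝 (s μ, (ρ μ : ℝ)) := by
    refine hGc.continuousAt ?_
    rw [← hraise μ hμ hq]
    exact mem_interior_iff_mem_nhds.1 hmem
  obtain ⟨ε, hε, hball⟩ := Metric.mem_nhds_iff.1 hmemG
  have e1 : ∀ᶠ ν in 𝓝 μ, (s ν, (ρ ν : ℝ)) ∈ Metric.ball (s μ, (ρ μ : ℝ)) ε :=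
    (hsc.prodMk_nhds (NNReal.tendsto_coe.2 hρc)) (Metric.ball_mem_nhds _ hε)
  have e2 : ∀ᶠ ν in 𝓝 μ, val hv ν (C ϖ) ≠ 0 := ((continuous_val hv _).tendsto μ).eventually_ne hμ
  have e3 : ∀ᶠ ν in 𝓝 μ, val hv ν (C q) ≠ 0 := ((continuous_val hv _).tendsto μ).eventually_ne hq
  have hB : IsPathConnected (Metric.ball (s μ, (ρ μ : ℝ)) ε) :=
    (convex_ball _ _).isPathConnected (Metric.nonempty_ball.2 hε)
  filter_upwards [hU, e1, e2, e3] with ν h0 h1 h2 h3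
  have j := ((hB.joinedIn _ (Metric.mem_ball_self hε) _ h1).map hGc).mono
    (Set.image_subset_iff.2 hball)
  rw [← hraise μ hμ hq, ← hraise ν h2 h3] at j
  exact (hconv.joinedIn_raise hw (mem_of_mem_nhds hU) j.source_mem).trans
    (j.trans (hconv.joinedIn_raise hw h0 j.target_mem).symm)

theorem locallyPathConnectedSpace (hw : w.Integers R) (hvw : ∀ x, v x = w (algebraMap R K x))
    {ϖ : R} (hϖ0 : 0 < w (algebraMap R K ϖ)) (hϖ1 : w (algebraMap R K ϖ) < 1) :
    LocallyPathConnectedSpace (AffineAnalyticLine v) where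
  path_connected_basis μ := by
    have hv := natCast_le_one hw hvw
    rw [hasBasis_self]
    intro O hO
    obtain ⟨U, hU, hUO, hconv⟩ := exists_linearlyConvex hw hv hO
    refine ⟨pathComponentIn U μ, ?_, isPathConnected_pathComponentIn (mem_of_mem_nhds hU),
      pathComponentIn_subset.trans hUO⟩
    by_cases h : val hv μ (C ϖ) = 0
    · exact pathComponentIn_mem_nhds_of_eq_zero hw hvw hv hϖ0 h hU hconv
    · exact pathComponentIn_mem_nhds_of_ne_zero hw hvw hv hϖ0 hϖ1 h hU hconv

end

end AffineAnalyticLine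

namespace AffineAnalyticLine

/-! ### The fibre over the given valuation -/

section

variable {R : Type*} [CommRing R] {K : Type*} [Field K] [Algebra R K]
  {w : Valuation K ℝ≥0} {v : AbsoluteValue R ℝ} {vK : AbsoluteValue K ℝ}

/-- A contractive seminorm restricts to the given absolute value on a field, since it is also
contractive at inverses. -/
lemma val_C_eq (hvK : ∀ x, vK x = w x) (hn : ∀ n : ℕ, vK n ≤ 1) (ν : AffineAnalyticLine vK)
    (x : K) : val hn ν (C x) = w x := by
  have hle : ∀ y, val hn ν (C y) ≤ w y := fun y => by
    have := val_C_le hn ν y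
    rw [hvK] at this
    exact_mod_cast this
  refine le_antisymm (hle x) ?_
  rcases eq_or_ne x 0 with rfl | hx
  · simp
  have h1 : val hn ν (C x) * val hn ν (C x⁻¹) = 1 := by
    rw [← map_mul, ← C_mul, mul_inv_cancel₀ hx, C_1, map_one]
  have h2 : val hn ν (C x⁻¹) ≤ (w x)⁻¹ := (hle x⁻¹).trans_eq (map_inv₀ w x)
  have hwx : 0 < w x := pos_iff_ne_zero.2 (w.ne_zero_iff.2 hx)
  calc w x = w x * (val hn ν (C x) * val hn ν (C x⁻¹)) := by rw [h1, mul_one]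
    _ ≤ w x * (val hn ν (C x) * (w x)⁻¹) := by gcongr
    _ = val hn ν (C x) := by field_simp

/-- Every polynomial over the field of fractions has a multiple with coefficients in `R`. -/
lemma exists_map_eq_C_mul [IsDomain R] [IsFractionRing R K] (g : K[X]) :
    ∃ b : R, algebraMap R K b ≠ 0 ∧ ∃ f : R[X],
      f.map (algebraMap R K) = C (algebraMap R K b) * g := by
  obtain ⟨b, hb, h⟩ := IsLocalization.integerNormalization_spec (nonZeroDivisors R) g
  refine ⟨b, ?_, _, h.trans ?_⟩
  · exact IsFractionRing.to_map_ne_zero_of_mem_nonZeroDivisors hb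
  · rw [← smul_eq_C_mul, algebraMap_smul]

/-- The restriction of a seminorm on `K[X]` to `R[X]`. -/
noncomputable def restrict (hvw : ∀ x, v x = w (algebraMap R K x)) (hvK : ∀ x, vK x = w x)
    (hn : ∀ n : ℕ, vK n ≤ 1) (ν : AffineAnalyticLine vK) : AffineAnalyticLine v :=
  ofVal ((val hn ν).comap (mapRingHom (algebraMap R K))) fun a => by
    rw [Valuation.comap_apply, coe_mapRingHom, map_C, val_C_eq hvK, hvw]

lemma val_restrict (hvw : ∀ x, v x = w (algebraMap R K x)) (hvK : ∀ x, vK x = w x)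
    (hn : ∀ n : ℕ, vK n ≤ 1) (hv : ∀ n : ℕ, v n ≤ 1) (ν : AffineAnalyticLine vK) (f : R[X]) :
    val hv (restrict hvw hvK hn ν) f = val hn ν (f.map (algebraMap R K)) := by
  simp [restrict]

lemma isInducing_restrict [IsDomain R] [IsFractionRing R K]
    (hvw : ∀ x, v x = w (algebraMap R K x)) (hvK : ∀ x, vK x = w x)
    (hn : ∀ n : ℕ, vK n ≤ 1) (hv : ∀ n : ℕ, v n ≤ 1) :
    IsInducing (restrict hvw hvK hn : AffineAnalyticLine vK → AffineAnalyticLine v) := by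
  rw [isInducing_iff_nhds]
  intro ν
  apply le_antisymm
  · rw [← tendsto_iff_comap, tendsto_iff hv]
    intro f
    simp only [val_restrict]
    exact (continuous_val hn _).tendsto ν
  · rw [← tendsto_id', tendsto_iff hn]
    intro g
    obtain ⟨b, hb, f, hf⟩ := exists_map_eq_C_mul (R := R) g
    have hwb : w (algebraMap R K b) ≠ 0 := w.ne_zero_iff.2 hb
    have h : ∀ ν, val hn ν g = (w (algebraMap R K b))⁻¹ * val hv (restrict hvw hvK hn ν) f := by
      intro ν
      rw [val_restrict, hf, map_mul, val_C_eq hvK, inv_mul_cancel_left₀ hwb]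
    simp only [h, id]
    exact tendsto_const_nhds.mul (((continuous_val hv f).tendsto _).comp tendsto_comap)

/-! ### Countability of the residue field -/

lemma residue_eq_zero_iff [IsLocalRing R] (hw : w.Integers R) {x : R} :
    IsLocalRing.residue R x = 0 ↔ w (algebraMap R K x) < 1 := by
  rw [IsLocalRing.residue_eq_zero_iff, IsLocalRing.mem_maximalIdeal, mem_nonunits_iff,
    hw.isUnit_iff_valuation_eq_one]
  exact ((hw.map_le_one x).lt_iff_ne).symm

/-- At the Gauss point over the trivial valuation of the residue field, the points `a` of the affine
line over the residue field converge to the Gauss point along the cofinite filter, but each of them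
is separated from it. -/
theorem countable_residueField [IsLocalRing R] [IsAlgClosed K] (hw : w.Integers R)
    (hvw : ∀ x, v x = w (algebraMap R K x)) [FirstCountableTopology (AffineAnalyticLine v)] :
    Countable (IsLocalRing.ResidueField R) := by
  have hv := natCast_le_one hw hvw
  have hle := coe_le_of_le hvw (resVal_le hw)
  obtain ⟨e, he⟩ := (IsLocalRing.residue_surjective (R := R)).hasRightInverse
  set G : AffineAnalyticLine v := disc (resVal hw) hle 1 0 with hG
  set η : IsLocalRing.ResidueField R → AffineAnalyticLine v :=
    fun a => disc (resVal hw) hle 0 (e a) with hη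
  have hres1 : ∀ x, resVal hw x ≤ 1 := fun x => (resVal_le hw x).trans (hw.map_le_one x)
  have hlim : Tendsto η cofinite (𝓝 G) := by
    rw [tendsto_iff_linear hw hv]
    intro c b
    simp only [hη, hG, val_disc_linear, mul_zero, mul_one, zero_le, sup_of_le_right,
      Algebra.algebraMap_self, RingHom.id_apply, zero_add]
    rcases (hw.map_le_one c).lt_or_eq with hc | hc
    · have h0 := resVal_of_lt hw hc
      have h : ∀ a, resVal hw (c * e a + b) = resVal hw b := fun a => by
        rw [add_comm]
        exact (resVal hw).map_add_supp b (by
          rw [Valuation.mem_supp_iff, map_mul, h0, zero_mul])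
      simp only [h, h0, zero_le, sup_of_le_right]
      exact tendsto_const_nhds
    · rw [resVal_of_eq hw hc, max_eq_left (hres1 b)]
      refine tendsto_nhds_of_eventually_eq ?_
      rw [eventually_cofinite]
      -- `c X + b` vanishes modulo the maximal ideal in at most one residue class.
      refine Set.Subsingleton.finite fun a ha a' ha' => ?_
      have hlt : ∀ x, ¬ resVal hw x = 1 → w (algebraMap R K x) < 1 := fun x hx =>
        (hw.map_le_one x).lt_or_eq.resolve_right fun h => hx (resVal_of_eq hw h)
      have h1 := w.map_sub_lt (hlt _ ha) (hlt _ ha')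
      rw [← map_sub, add_sub_add_right_eq_sub, ← mul_sub, map_mul, map_mul, hc, one_mul,
        ← residue_eq_zero_iff hw, map_sub, he, he, sub_eq_zero] at h1
      exact h1
  obtain ⟨V, hV⟩ := (𝓝 G).exists_antitone_basis
  -- The branch of `a` leaves the neighbourhood of `G` where `X - e a` does not vanish.
  have hcov : (Set.univ : Set (IsLocalRing.ResidueField R)) ⊆ ⋃ n, {a | ¬ η a ∈ V n} := by
    intro a _
    have hmem : {ν : AffineAnalyticLine v | val hv ν (C 1 * X + C (-e a)) ≠ 0} ∈ 𝓝 G := by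
      refine ((continuous_val hv _).tendsto G).eventually_ne ?_
      rw [hG, val_disc_linear]
      simp
    obtain ⟨n, hn⟩ := hV.mem_iff.1 hmem
    refine Set.mem_iUnion.2 ⟨n, fun h => hn h ?_⟩
    rw [hη, val_disc_linear]
    simp
  rw [← Set.countable_univ_iff]
  refine (Set.countable_iUnion fun n => ?_).mono hcov
  exact (eventually_cofinite.1 (hlim (hV.mem n))).countable

/-! ### First countability over the residue field -/

lemma tendsto_valuation_add {B ι : Type*} [CommRing B] {N : ι → Valuation B ℝ≥0} {l : Filter ι}
    {x y : B} {L : ℝ≥0} (hx : Tendsto (fun i => N i x) l (𝓝 L))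
    (hy : Tendsto (fun i => N i y) l (𝓝 0)) : Tendsto (fun i => N i (x + y)) l (𝓝 L) := by
  have h1 : Tendsto (fun i => N i x - N i y) l (𝓝 L) := by simpa using hx.sub hy
  have h2 : Tendsto (fun i => N i x + N i y) l (𝓝 L) := by simpa using hx.add hy
  refine tendsto_of_tendsto_of_tendsto_of_le_of_le h1 h2 (fun i => ?_) fun i => ?_
  · have := (N i).map_sub (x + y) y
    rw [add_sub_cancel_right] at this
    exact tsub_le_iff_right.2 (this.trans (max_le_add_of_nonneg zero_le zero_le))
  · exact ((N i).map_add x y).trans (max_le_add_of_nonneg zero_le zero_le)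

/-- Near a point over the trivial valuation of the residue field, the topology is generated by the
value of one nonzero nonunit `ϖ` and those of `X + a`, for `a` in a set of representatives of the
residue field: the values of all nonunits are small as soon as that of `ϖ` is. -/
lemma isCountablyGenerated_nhds_of_eq_zero [IsLocalRing R] [IsAlgClosed K] (hw : w.Integers R)
    (hvw : ∀ x, v x = w (algebraMap R K x)) (hv : ∀ n : ℕ, v n ≤ 1)
    [Countable (IsLocalRing.ResidueField R)] {ϖ : R} (hϖ0 : 0 < w (algebraMap R K ϖ))
    {μ : AffineAnalyticLine v} (hμ : val hv μ (C ϖ) = 0) : (𝓝 μ).IsCountablyGenerated := by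
  obtain ⟨e, he⟩ := (IsLocalRing.residue_surjective (R := R)).hasRightInverse
  set l : Filter (AffineAnalyticLine v) := comap (fun ν => val hv ν (C ϖ)) (𝓝 0) ⊓
    ⨅ a : IsLocalRing.ResidueField R, comap (fun ν => val hv ν (X + C (e a)))
      (𝓝 (val hv μ (X + C (e a)))) with hl
  have hresμ : ∀ d, w (algebraMap R K d) < 1 → val hv μ (C d) = 0 := fun d hd => by
    have h := contractive_eq_resVal hw (val_C_le_val hvw hv μ) hϖ0 hμ
    rw [← resVal_of_lt hw hd, ← h]
    rfl
  have hunit : ∀ d, w (algebraMap R K d) = 1 → ∀ ν, val hv ν (C d) = 1 := fun d hd ν =>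
    contractive_apply_eq_one hw (val_C_le_val hvw hv ν) hd
  have hsmall : ∀ d, w (algebraMap R K d) < 1 →
      Tendsto (fun ν => val hv ν (C d)) l (𝓝 0) := by
    intro d hd
    obtain ⟨n, hn⟩ := exists_pow_lt_of_lt_one hϖ0 hd
    have hn0 : n ≠ 0 := by
      rintro rfl
      rw [pow_zero] at hn
      exact absurd (hw.map_le_one ϖ) (not_le.2 hn)
    have h1 : Tendsto (fun ν => val hv ν (C ϖ)) l (𝓝 0) := tendsto_comap.mono_left inf_le_left
    have hninv : (0 : ℝ) < (n : ℝ)⁻¹ := by positivity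
    have h2 : Tendsto (fun ν => val hv ν (C ϖ) ^ (n : ℝ)⁻¹) l (𝓝 0) := by
      have := ((NNReal.continuous_rpow_const hninv.le).tendsto 0).comp h1
      rwa [NNReal.zero_rpow hninv.ne'] at this
    refine tendsto_of_tendsto_of_tendsto_of_le_of_le tendsto_const_nhds h2 (fun _ => zero_le)
      fun ν => ?_
    have h3 := contractive_apply_le_apply hw (val_C_le_val hvw hv ν) (x := d ^ n) (y := ϖ)
      (by simpa using hn.le)
    rw [map_pow] at h3
    have h4 := NNReal.rpow_le_rpow h3 hninv.le
    rwa [NNReal.pow_rpow_inv_natCast _ hn0] at h4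
  have hmonic : ∀ b, Tendsto (fun ν => val hv ν (X + C b)) l (𝓝 (val hv μ (X + C b))) := by
    intro b
    set a := IsLocalRing.residue R b
    have hd : w (algebraMap R K (b - e a)) < 1 := by
      rw [← residue_eq_zero_iff hw, map_sub, he, sub_self]
    have hb : (X + C b : R[X]) = (X + C (e a)) + C (b - e a) := by
      rw [C_sub]; ring
    rw [hb, (val hv μ).map_add_supp _ ((Valuation.mem_supp_iff _ _).2 (hresμ _ hd))]
    exact tendsto_valuation_add (tendsto_comap.mono_left (inf_le_right.trans (iInf_le _ a)))
      (hsmall _ hd)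
  have key : 𝓝 μ = l := by
    apply le_antisymm
    · refine le_inf ?_ (le_iInf fun a => ?_)
      · rw [← tendsto_iff_comap, ← hμ]
        exact (continuous_val hv _).tendsto μ
      · rw [← tendsto_iff_comap]
        exact (continuous_val hv _).tendsto μ
    · rw [← tendsto_id', tendsto_iff_linear hw hv]
      intro a b
      simp only [id]
      rcases (hw.map_le_one a).lt_or_eq with ha | ha
      · have h1 : Tendsto (fun ν => val hv ν (C a * X)) l (𝓝 0) := by
          have h := (hsmall a ha).mul (hmonic 0)
          simpa using h
        have h2 : Tendsto (fun ν => val hv ν (C b)) l (𝓝 (val hv μ (C b))) := by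
          rcases (hw.map_le_one b).lt_or_eq with hb | hb
          · rw [hresμ b hb]
            exact hsmall b hb
          · simp only [hunit b hb]
            exact tendsto_const_nhds
        rw [add_comm, (val hv μ).map_add_supp _ ((Valuation.mem_supp_iff _ _).2
          (by rw [map_mul, hresμ a ha, zero_mul]))]
        exact tendsto_valuation_add h2 h1
      · obtain ⟨b', rfl⟩ := hw.dvd_of_le (x := b) (y := a) (by rw [ha]; exact hw.map_le_one b)
        have h : ∀ ν, val hv ν (C a * X + C (a * b')) = val hv ν (X + C b') := fun ν => by
          rw [C_mul, ← mul_add, map_mul, hunit a ha, one_mul]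
        simp only [h]
        exact hmonic b'
  rw [key]
  infer_instance

/-! ### First countability at the other points -/

attribute [local instance] Polynomial.algebra Polynomial.isLocalization in
/-- Over a base valuation that is the power `s` of the given one, a point is the power `s` of a
point of the affine line over the field of fractions. -/
lemma exists_eq_rpow [IsDomain R] [IsFractionRing R K] (hvK : ∀ x, vK x = w x)
    (hn : ∀ n : ℕ, vK n ≤ 1) (hv : ∀ n : ℕ, v n ≤ 1) (μ : AffineAnalyticLine v) {s : ℝ}
    (hs : 0 < s) (hμ : ∀ x, val hv μ (C x) = w (algebraMap R K x) ^ s) :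
    ∃ ν : AffineAnalyticLine vK, ∀ f, val hv μ f = val hn ν (f.map (algebraMap R K)) ^ s := by
  have hsupp : (nonZeroDivisors R).map (C : R →+* R[X]) ≤ (val hv μ).supp.primeCompl := by
    rintro _ ⟨b, hb, rfl⟩
    change C b ∉ (val hv μ).supp
    rw [Valuation.mem_supp_iff]
    change ¬ val hv μ (C b) = 0
    rw [hμ, NNReal.rpow_eq_zero hs.ne', w.zero_iff]
    exact IsFractionRing.to_map_ne_zero_of_mem_nonZeroDivisors hb
  set N := (val hv μ).extendToLocalization hsupp K[X] with hN
  have hNf : ∀ f : R[X], N (f.map (algebraMap R K)) = val hv μ f := fun f =>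
    (val hv μ).extendToLocalization_apply_map_apply hsupp K[X] f
  have hNC : ∀ x : K, N (C x) = w x ^ s := by
    intro x
    obtain ⟨a, b, hb, rfl⟩ := IsFractionRing.div_surjective (A := R) x
    have hb0 : algebraMap R K b ≠ 0 := IsFractionRing.to_map_ne_zero_of_mem_nonZeroDivisors hb
    have ha : N (C (algebraMap R K a)) = w (algebraMap R K a) ^ s := by
      rw [← hμ, ← hNf, map_C]
    have hb' : N (C (algebraMap R K b)) = w (algebraMap R K b) ^ s := by
      rw [← hμ, ← hNf, map_C]
    have hwb : w (algebraMap R K b) ^ s ≠ 0 := by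
      rw [ne_eq, NNReal.rpow_eq_zero hs.ne', w.zero_iff]
      exact hb0
    rw [map_div₀ w, NNReal.div_rpow, eq_div_iff hwb, ← hb', ← map_mul, ← C_mul,
      div_mul_cancel₀ _ hb0, ha]
  refine ⟨ofVal (powVal N s⁻¹ (inv_pos.2 hs)) fun x => ?_, fun f => ?_⟩
  · rw [powVal_apply, hNC, NNReal.rpow_rpow_inv hs.ne', hvK]
  · rw [val_ofVal, powVal_apply, NNReal.rpow_inv_rpow hs.ne', hNf]

/-- The open set of points over powers of the given valuation is homeomorphic to a subspace of the
product of `ℝ` and the affine line over the field of fractions. -/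
lemma isCountablyGenerated_nhds_of_ne_zero [IsDomain R] [IsFractionRing R K] (hw : w.Integers R)
    (hvw : ∀ x, v x = w (algebraMap R K x)) (hvK : ∀ x, vK x = w x) (hv : ∀ n : ℕ, v n ≤ 1)
    (hn : ∀ n : ℕ, vK n ≤ 1)
    [FirstCountableTopology (AffineAnalyticLine vK)] {ϖ : R} (hϖ0 : 0 < w (algebraMap R K ϖ))
    (hϖ1 : w (algebraMap R K ϖ) < 1)
    {μ : AffineAnalyticLine v} (hμ : val hv μ (C ϖ) ≠ 0) : (𝓝 μ).IsCountablyGenerated := by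
  set W : Set (AffineAnalyticLine v) := {ν | val hv ν (C ϖ) ≠ 0} with hW
  have hWo : IsOpen W := isOpen_ne_fun (continuous_val hv _) continuous_const
  set s : W → ℝ := fun ν => Real.log (val hv ν.1 (C ϖ)) / Real.log (w (algebraMap R K ϖ)) with hs
  have hpow : ∀ ν : W, 1 ≤ s ν ∧ ∀ x, val hv ν.1 (C x) = w (algebraMap R K x) ^ s ν :=
    fun ν => contractive_eq_rpow hw (val_C_le_val hvw hv ν.1) hϖ0 hϖ1 ν.2
  have hspos : ∀ ν, 0 < s ν := fun ν => by linarith [(hpow ν).1]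
  choose Φ hΦ using fun ν : W => exists_eq_rpow hvK hn hv ν.1 (hspos ν) (hpow ν).2
  have hsc : Continuous s := by
    refine Continuous.div_const (Continuous.log ?_ fun ν => ?_) _
    · exact NNReal.continuous_coe.comp ((continuous_val hv _).comp continuous_subtype_val)
    · exact_mod_cast ν.2
  have hrpow : ∀ {l : Filter W} {x : W → ℝ≥0} {y : W → ℝ} {x₀ : ℝ≥0} {y₀ : ℝ}, 0 < y₀ →
      Tendsto x l (𝓝 x₀) → Tendsto y l (𝓝 y₀) →
      Tendsto (fun ν => x ν ^ y ν) l (𝓝 (x₀ ^ y₀)) := fun hy0 hx hy =>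
    hx.nnrpow hy (Or.inr hy0)
  have hind : IsInducing fun ν : W => (s ν, Φ ν) := by
    rw [isInducing_iff_nhds]
    intro ν
    apply le_antisymm
    · rw [← tendsto_iff_comap, nhds_prod_eq]
      refine (hsc.tendsto ν).prodMk ((tendsto_iff hn).2 fun g => ?_)
      obtain ⟨b, hb, f, hf⟩ := exists_map_eq_C_mul (R := R) g
      have hwb : w (algebraMap R K b) ≠ 0 := w.ne_zero_iff.2 hb
      have h : ∀ ν, val hn (Φ ν) g =
          (w (algebraMap R K b))⁻¹ * val hv ν.1 f ^ (s ν)⁻¹ := by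
        intro ν
        rw [hΦ, NNReal.rpow_rpow_inv (hspos ν).ne', hf, map_mul, val_C_eq hvK,
          inv_mul_cancel_left₀ hwb]
      simp only [h]
      exact tendsto_const_nhds.mul (hrpow (inv_pos.2 (hspos ν))
        (((continuous_val hv f).comp continuous_subtype_val).tendsto ν)
        ((hsc.tendsto ν).inv₀ (hspos ν).ne'))
    · rw [nhds_induced, ← tendsto_iff_comap, tendsto_iff hv]
      intro f
      simp only [hΦ]
      have h : Tendsto (fun ν : W => (s ν, Φ ν)) (comap (fun ν : W => (s ν, Φ ν))
        (𝓝 (s ν, Φ ν))) (𝓝 (s ν, Φ ν)) := tendsto_comap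
      exact hrpow (hspos ν)
        (((continuous_val hn _).tendsto _).comp ((continuous_snd.tendsto _).comp h))
        ((continuous_fst.tendsto _).comp h)
  have : FirstCountableTopology W := hind.firstCountableTopology
  rw [← map_nhds_subtype_coe_eq_nhds (p := (· ∈ W)) hμ (hWo.mem_nhds hμ)]
  infer_instance

theorem firstCountableTopology_iff [IsDomain R] [IsLocalRing R] [IsFractionRing R K]
    [IsAlgClosed K] (hw : w.Integers R) (hvw : ∀ x, v x = w (algebraMap R K x))
    (hvK : ∀ x, vK x = w x) {ϖ : R} (hϖ0 : 0 < w (algebraMap R K ϖ))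
    (hϖ1 : w (algebraMap R K ϖ) < 1) :
    FirstCountableTopology (AffineAnalyticLine v) ↔
      Countable (IsLocalRing.ResidueField R) ∧ FirstCountableTopology (AffineAnalyticLine vK) := by
  have hv := natCast_le_one hw hvw
  have hn : ∀ n : ℕ, vK n ≤ 1 := fun n => by
    rw [hvK, ← map_natCast (algebraMap R K)]
    exact NNReal.coe_le_one.2 (hw.map_le_one _)
  constructor
  · intro h
    exact ⟨countable_residueField hw hvw,
      (isInducing_restrict hvw hvK hn hv).firstCountableTopology⟩
  · rintro ⟨h1, h2⟩
    refine ⟨fun μ => ?_⟩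
    by_cases h : val hv μ (C ϖ) = 0
    · exact isCountablyGenerated_nhds_of_eq_zero hw hvw hv hϖ0 h
    · exact isCountablyGenerated_nhds_of_ne_zero hw hvw hvK hv hn hϖ0 hϖ1 h

end

end AffineAnalyticLine

theorem mainTheorem2 (R : Type*) [CommRing R] [IsDomain R] [ValuationRing R]
    (K : Type*) [Field K] [Algebra R K] [IsFractionRing R K]
    (ρ : ValuationRing.ValueGroup R K →*₀ ℝ≥0) (hρ : StrictMono ρ)
    (hcomplete : CompleteSpace (WithAbs (ValuationRing.inducedAbsOnRing R K ρ hρ)))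
    (hfield : ¬ IsField R) (hclosed : IsAlgClosed K) :
    PathConnectedSpace (AffineAnalyticLine (ValuationRing.inducedAbsOnRing R K ρ hρ)) ∧
    LocallyPathConnectedSpace (AffineAnalyticLine (ValuationRing.inducedAbsOnRing R K ρ hρ)) ∧
    (FirstCountableTopology (AffineAnalyticLine (ValuationRing.inducedAbsOnRing R K ρ hρ)) ↔
      Countable (IsLocalRing.ResidueField R) ∧
      FirstCountableTopology (AffineAnalyticLine (ValuationRing.inducedAbs R K ρ hρ))) := by
  set w : Valuation K ℝ≥0 := (ValuationRing.valuation R K).map ρ hρ.monotone with hwdef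
  have hmem : ∀ x, w x ≤ 1 ↔ ∃ a, algebraMap R K a = x := by
    intro x
    rw [← ValuationRing.mem_integer_iff R K x, Valuation.mem_integer_iff, hwdef,
      Valuation.map_apply, ← map_one ρ, hρ.le_iff_le]
  have hw : w.Integers R :=
    ⟨IsFractionRing.injective R K, fun a => (hmem _).2 ⟨a, rfl⟩, fun x hx => (hmem x).1 hx⟩
  have hvw : ∀ x, ValuationRing.inducedAbsOnRing R K ρ hρ x = w (algebraMap R K x) := fun _ => rfl
  have hvK : ∀ x, ValuationRing.inducedAbs R K ρ hρ x = w x := fun _ => rfl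
  obtain ⟨ϖ, hϖ0, hϖu⟩ := Ring.exists_not_isUnit_of_not_isField hfield
  have hϖpos : 0 < w (algebraMap R K ϖ) :=
    pos_iff_ne_zero.2 (w.ne_zero_iff.2 ((map_ne_zero_iff _ hw.hom_inj).2 hϖ0))
  have hϖ1 : w (algebraMap R K ϖ) < 1 := (hw.map_le_one ϖ).lt_of_ne fun h =>
    hϖu (hw.isUnit_iff_valuation_eq_one.2 h)
  exact ⟨AffineAnalyticLine.pathConnectedSpace hw hvw,
    AffineAnalyticLine.locallyPathConnectedSpace hw hvw hϖpos hϖ1,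
    AffineAnalyticLine.firstCountableTopology_iff hw hvw hvK hϖpos hϖ1⟩
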